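/- Query model. A quantum query algorithm for an unknown $n\times n$ unitary $U$ starts from $|\mathrm{init}\rangle|0\rangle|\psi\rangle$ (finite-dimensional workspace, control qubit, system register), alternates fixed unitaries of the whole memory with controlled applications of $U$ or $U^{-1}$, measures the memory in the computational basis and outputs a real number depending on the outcome. Its number of queries (which, the queries being sequential, is also its depth) is the number of controlled applications of $U^{\pm1}$. For independent runs executed in parallel, the depth $D$ is the largest depth of a run and the total query complexity $N$ is the sum of the numbers of queries. Unbiased phase estimation (Cornelissen et al.). Call a family of such algorithms, indexed by the dimension $n$ and real parameters $K\ge 1$, $B\in(0,1)$, an unbiased phase estimator if, for every unitary $U$ and unit vector $|\psi\rangle$ with $U|\psi\rangle=e^{2\pi i\theta}|\psi\rangle$, $\theta\in[0,1/2]$, its output $\tilde\theta\in[-1,1]$ satisfies $$|\mathbb E[\tilde\theta]-\theta|\le B,\qquad \mathrm{Var}[\tilde\theta]\le \frac1{K^2}+B,$$ and it uses $O(K\log(K/B))$ queries (for every $B_1<1$ there is a constant, independent of $n,K,B$, that works for all $K\ge1$ and $0<B\le B_1$). Proposition. An unbiased phase estimator exists. Moreover, let any unbiased phase estimator be given, let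 $\beta\in[0,1]$ and $\epsilon_\circ\in(0,1)$, and run it independently $T=\lceil\epsilon_\circ^{-2\beta}\rceil$ times with $$K=\sqrt3\,\epsilon_\circ^{-1+\beta},\qquad B=\min\Big(\tfrac19\epsilon_\circ^{2-2\beta},\,0.05\,\epsilon_\circ\Big).$$ Then, for all $U,|\psi\rangle,\theta$ as above, the sample mean $\bar\theta$ of the $T$ outputs satisfies $P[|\bar\theta-\theta|\le\epsilon_\circ]>1/2$, and the resources are $$D=O\big(\epsilon_\circ^{-1+\beta}\log(\epsilon_\circ^{-1})\big),\qquad N=O\big(\epsilon_\circ^{-1-\beta}\log(\epsilon_\circ^{-1})\big),$$ that is, for every $\epsilon_1<1$ there is a constant, depending only on $\epsilon_1$ and the estimator (not on $\beta,\epsilon_\circ,n,U,\psi,\theta$), with which both bounds hold for all $\beta\in[0,1]$ and $0<\epsilon_\circ\le\epsilon_1$. -/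

import Mathlib

open MeasureTheory

noncomputable section

/-- A quantum query algorithm for an unknown unitary acting on an `n`-dimensional system.
The memory is a `w`-dimensional workspace, a control qubit and the system register, in which the
input state is supplied.  The algorithm applies the gate `first`, and then, for each entry
`(d, G)` of `steps`, one controlled application of the unknown unitary (of its inverse if
`d = true`) followed by the gate `G`.  Gates are arbitrary unitaries of the whole memory that are
fixed in advance.  At the end the memory is measured in the computational basis, and the real
number `output x` is returned on outcome `x`. -/
structure QueryAlgorithm (n : ℕ) where
  w : ℕ
  init : Fin w
  first : Matrix.unitaryGroup (Fin w × Bool × Fin n) ℂ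
  steps : List (Bool × Matrix.unitaryGroup (Fin w × Bool × Fin n) ℂ)
  output : Fin w × Bool × Fin n → ℝ

/-- The operator `V` on the system register, controlled by the control qubit. -/
def controlledApply {w n : ℕ} (V : Matrix (Fin n) (Fin n) ℂ) (φ : Fin w × Bool × Fin n → ℂ) :
    Fin w × Bool × Fin n → ℂ :=
  fun x => if x.2.1 = true then (V.mulVec fun s => φ (x.1, true, s)) x.2.2 else φ x

namespace QueryAlgorithm

variable {n : ℕ}

/-- The number of (sequential) uses of the controlled unknown unitary or its inverse.  For one
run this is both the query complexity and the circuit depth. -/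
def queries (A : QueryAlgorithm n) : ℕ := A.steps.length

/-- The state `|init⟩ ⊗ |0⟩ ⊗ ψ`. -/
def initialState (A : QueryAlgorithm n) (ψ : EuclideanSpace ℂ (Fin n)) :
    Fin A.w × Bool × Fin n → ℂ :=
  fun x => if x.1 = A.init ∧ x.2.1 = false then ψ x.2.2 else 0

/-- The state before the measurement, when the unknown unitary is `U` and the input is `ψ`. -/
def finalState (A : QueryAlgorithm n) (U : Matrix.unitaryGroup (Fin n) ℂ)
    (ψ : EuclideanSpace ℂ (Fin n)) : Fin A.w × Bool × Fin n → ℂ :=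
  A.steps.foldl
    (fun φ st => st.2.val.mulVec
      (controlledApply (if st.1 = true then (U⁻¹).val else U.val) φ))
    (A.first.val.mulVec (A.initialState ψ))

/-- The law of the returned real number (Born rule). -/
def outputLaw (A : QueryAlgorithm n) (U : Matrix.unitaryGroup (Fin n) ℂ)
    (ψ : EuclideanSpace ℂ (Fin n)) : Measure ℝ :=
  ∑ x, ENNReal.ofReal (‖A.finalState U ψ x‖ ^ 2) • Measure.dirac (A.output x)

end QueryAlgorithm

/-- `ψ` is a (unit) eigenvector of `U` with eigenvalue `e^{2πiθ}`, `θ ∈ [0, 1/2]`. -/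
def IsPhaseInstance {n : ℕ} (U : Matrix.unitaryGroup (Fin n) ℂ) (ψ : EuclideanSpace ℂ (Fin n))
    (θ : ℝ) : Prop :=
  ‖ψ‖ = 1 ∧ θ ∈ Set.Icc (0 : ℝ) (1 / 2) ∧
    U.val.mulVec ψ.ofLp = Complex.exp (2 * Real.pi * Complex.I * θ) • ψ.ofLp

/-- `A n K B` is an unbiased phase estimation algorithm with parameters `K ≥ 1` and
`B ∈ (0, 1)`, for unitaries of dimension `n`: the estimates lie in `[-1, 1]`, the bias is at most
`B`, the variance is at most `1 / K ^ 2 + B`, and `O(K log (K / B))` queries are used.  The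
constant in the `O` is absolute, apart from the requirement that `B` stay away from `1`, where
`log (K / B)` may vanish. -/
structure IsUnbiasedPhaseEstimation (A : (n : ℕ) → ℝ → ℝ → QueryAlgorithm n) : Prop where
  output_mem : ∀ (n : ℕ) (K B : ℝ), 1 ≤ K → 0 < B → B < 1 →
    ∀ x, (A n K B).output x ∈ Set.Icc (-1 : ℝ) 1
  bias : ∀ (n : ℕ) (K B : ℝ), 1 ≤ K → 0 < B → B < 1 →
    ∀ (U : Matrix.unitaryGroup (Fin n) ℂ) (ψ : EuclideanSpace ℂ (Fin n)) (θ : ℝ),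
      IsPhaseInstance U ψ θ → |(∫ y, y ∂((A n K B).outputLaw U ψ)) - θ| ≤ B
  variance : ∀ (n : ℕ) (K B : ℝ), 1 ≤ K → 0 < B → B < 1 →
    ∀ (U : Matrix.unitaryGroup (Fin n) ℂ) (ψ : EuclideanSpace ℂ (Fin n)) (θ : ℝ),
      IsPhaseInstance U ψ θ →
        ProbabilityTheory.variance id ((A n K B).outputLaw U ψ) ≤ 1 / K ^ 2 + B
  queries_le : ∀ B₁ : ℝ, B₁ < 1 → ∃ C : ℝ, ∀ (n : ℕ) (K B : ℝ), 1 ≤ K → 0 < B → B ≤ B₁ →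
    ((A n K B).queries : ℝ) ≤ C * (K * Real.log (K / B))

/-! Independent runs of query algorithms, executed in parallel. -/

/-- The depth of the parallel execution: the largest depth of a run. -/
def parallelDepth {n T : ℕ} (R : Fin T → QueryAlgorithm n) : ℕ :=
  Finset.univ.sup fun i => (R i).queries

/-- The total number of queries of all runs. -/
def totalQueries {n T : ℕ} (R : Fin T → QueryAlgorithm n) : ℕ :=
  ∑ i, (R i).queries

/-- The law of the sample mean of the outputs of the independent runs. -/
def sampleMeanLaw {n T : ℕ} (R : Fin T → QueryAlgorithm n) (U : Matrix.unitaryGroup (Fin n) ℂ)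
    (ψ : EuclideanSpace ℂ (Fin n)) : Measure ℝ :=
  (Measure.pi fun i => (R i).outputLaw U ψ).map fun y => (∑ i, y i) / T

/-- `T = ⌈ε ^ (-2β)⌉` runs of the algorithm `A` with the parameters `K = √3 ε ^ (-1 + β)` and
`B = min (ε ^ (2 - 2β) / 9) (0.05 ε)`. -/
def lowDepthRuns (A : (n : ℕ) → ℝ → ℝ → QueryAlgorithm n) (n : ℕ) (β ε : ℝ) :
    Fin ⌈ε ^ (-2 * β)⌉₊ → QueryAlgorithm n :=
  fun _ => A n (√3 * ε ^ (-1 + β)) (min (1 / 9 * ε ^ (2 - 2 * β)) (0.05 * ε))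

end

noncomputable section

/-! Accuracy of the mean is Chebyshev's inequality (`sampleMeanLaw_const_gt_half`): averaging
divides the variance by `T` but leaves the bias, so the tolerance `ε` is split into `0.05 ε` for
bias and `0.95 ε` for fluctuation. The resource bounds follow because `K / B` is at most polynomial
in `1 / ε`.

For existence, a superposition with real amplitudes `a k` is prepared, phase kickback gives branch
`k` the phase `e^{2πiθ(k+1)}`, and a Fourier transform is measured on a grid of `4R` points in
`[-1/4, 3/4)`. The error `t` has weight `q t / (4R)`, where `q t = ‖∑ a k e^{2πikt}‖²`
(`norm_sq_gridFourier_mulVec`). Taking the coefficients of `(1 + z + ⋯ + z^(m-1))^L`, normalized,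
makes `q` at most `M / 4^L` once `1/m ≤ |t| ≤ 3/4`, with `M = (m-1)L + 1`. This controls the second
moment (`sum_sq_error_le`).

The bias is small because `q` is even: when `θ` is a grid point, opposite errors near `θ` cancel
exactly (`sum_error_grid_le`). For other `θ`, rounding to the grid costs only `O(M²/R)`, since `q`
is Lipschitz (`abs_sum_error_le`). The grid size does not affect the query count, so `R` can be as
large as needed, while `m` of order `K` and `L` of order `log (K/B)` suffice. -/

/-! ### Norm preservation and the output law -/

theorem sum_norm_sq_mulVec {ι : Type*} [Fintype ι] [DecidableEq ι]
    (V : Matrix.unitaryGroup ι ℂ) (v : ι → ℂ) :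
    ∑ i, ‖V.val.mulVec v i‖ ^ 2 = ∑ i, ‖v i‖ ^ 2 := by
  have key : ∀ w : ι → ℂ, ((∑ i, ‖w i‖ ^ 2 : ℝ) : ℂ) = star w ⬝ᵥ w := by
    intro w
    simp only [dotProduct, Pi.star_apply, RCLike.star_def]
    push_cast
    exact Finset.sum_congr rfl fun i _ => (Complex.conj_mul' (w i)).symm
  have h : star V.val * V.val = 1 := Matrix.mem_unitaryGroup_iff'.1 V.2
  have : ((∑ i, ‖V.val.mulVec v i‖ ^ 2 : ℝ) : ℂ) = ((∑ i, ‖v i‖ ^ 2 : ℝ) : ℂ) := by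
    rw [key, key, Matrix.star_mulVec, ← Matrix.dotProduct_mulVec, Matrix.mulVec_mulVec,
      ← Matrix.star_eq_conjTranspose, h, Matrix.one_mulVec]
  exact_mod_cast this

theorem sum_norm_sq_controlledApply {w n : ℕ} (V : Matrix.unitaryGroup (Fin n) ℂ)
    (φ : Fin w × Bool × Fin n → ℂ) :
    ∑ x, ‖controlledApply V.val φ x‖ ^ 2 = ∑ x, ‖φ x‖ ^ 2 := by
  simp only [Fintype.sum_prod_type, Fintype.sum_bool, controlledApply, if_true,
    Bool.false_eq_true, if_false]
  refine Finset.sum_congr rfl fun i _ => ?_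
  rw [sum_norm_sq_mulVec V]

theorem sum_norm_sq_eq_one {n : ℕ} {ψ : EuclideanSpace ℂ (Fin n)} (h : ‖ψ‖ = 1) :
    ∑ s, ‖ψ s‖ ^ 2 = 1 := by
  rw [← EuclideanSpace.norm_sq_eq, h, one_pow]

namespace QueryAlgorithm

variable {n : ℕ}

theorem sum_norm_sq_initialState (A : QueryAlgorithm n) {ψ : EuclideanSpace ℂ (Fin n)}
    (h : ‖ψ‖ = 1) : ∑ x, ‖A.initialState ψ x‖ ^ 2 = 1 := by
  simp only [Fintype.sum_prod_type, Fintype.sum_bool, initialState]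
  rw [Finset.sum_eq_single A.init]
  · simpa using sum_norm_sq_eq_one h
  · intro i _ hi
    simp [hi]
  · simp

theorem sum_norm_sq_finalState (A : QueryAlgorithm n) (U : Matrix.unitaryGroup (Fin n) ℂ)
    {ψ : EuclideanSpace ℂ (Fin n)} (h : ‖ψ‖ = 1) : ∑ x, ‖A.finalState U ψ x‖ ^ 2 = 1 := by
  have key : ∀ (l : List (Bool × Matrix.unitaryGroup (Fin A.w × Bool × Fin n) ℂ))
      (φ : Fin A.w × Bool × Fin n → ℂ),
      ∑ x, ‖l.foldl (fun φ st => st.2.val.mulVec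
        (controlledApply (if st.1 = true then (U⁻¹).val else U.val) φ)) φ x‖ ^ 2 =
        ∑ x, ‖φ x‖ ^ 2 := by
    intro l
    induction l with
    | nil => intro φ; rfl
    | cons st l ih =>
      intro φ
      rw [List.foldl_cons, ih, sum_norm_sq_mulVec]
      split_ifs <;> exact sum_norm_sq_controlledApply _ _
  rw [finalState, key, sum_norm_sq_mulVec, sum_norm_sq_initialState A h]

theorem isProbabilityMeasure_outputLaw (A : QueryAlgorithm n) (U : Matrix.unitaryGroup (Fin n) ℂ)
    {ψ : EuclideanSpace ℂ (Fin n)} (h : ‖ψ‖ = 1) : IsProbabilityMeasure (A.outputLaw U ψ) := by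
  constructor
  simp only [outputLaw, Measure.finsetSum_apply, Measure.smul_apply, measure_univ, smul_eq_mul,
    mul_one]
  rw [← ENNReal.ofReal_sum_of_nonneg fun _ _ => by positivity, sum_norm_sq_finalState A U h,
    ENNReal.ofReal_one]

theorem integral_outputLaw (A : QueryAlgorithm n) (U : Matrix.unitaryGroup (Fin n) ℂ)
    (ψ : EuclideanSpace ℂ (Fin n)) (f : ℝ → ℝ) :
    ∫ y, f y ∂(A.outputLaw U ψ) = ∑ x, ‖A.finalState U ψ x‖ ^ 2 * f (A.output x) := by
  rw [outputLaw, integral_finsetSum_measure]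
  · refine Finset.sum_congr rfl fun x _ => ?_
    rw [integral_smul_measure, integral_dirac, ENNReal.toReal_ofReal (by positivity), smul_eq_mul]
  · intro x _
    exact (integrable_dirac (by simp)).smul_measure ENNReal.ofReal_ne_top

/-- The law is carried by finitely many outputs, so the sum of their absolute values is an almost
sure bound. -/
theorem memLp_id_outputLaw (A : QueryAlgorithm n) (U : Matrix.unitaryGroup (Fin n) ℂ)
    {ψ : EuclideanSpace ℂ (Fin n)} (h : ‖ψ‖ = 1) : MemLp id 2 (A.outputLaw U ψ) := by
  have := A.isProbabilityMeasure_outputLaw U h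
  refine MemLp.of_bound aestronglyMeasurable_id (∑ x, ‖A.output x‖) ?_
  rw [outputLaw, ae_finsetSum_measure_iff]
  intro x hx
  refine Measure.ae_smul_measure ?_ _
  rw [ae_dirac_eq]
  exact Finset.single_le_sum (f := fun x => ‖A.output x‖) (fun _ _ => norm_nonneg _) hx

end QueryAlgorithm

/-! ### Accuracy and cost of the averaged estimator -/

theorem sampleMeanLaw_const_gt_half {n T : ℕ} (hT : 0 < T) (A : QueryAlgorithm n)
    (U : Matrix.unitaryGroup (Fin n) ℂ) {ψ : EuclideanSpace ℂ (Fin n)} (hψ : ‖ψ‖ = 1)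
    {θ ε : ℝ} (hε : 0 < ε) (hbias : |(∫ y, y ∂(A.outputLaw U ψ)) - θ| ≤ 0.05 * ε)
    (hvar : ProbabilityTheory.variance id (A.outputLaw U ψ) ≤ 4 / 9 * ε ^ 2 * T) :
    1 / 2 < sampleMeanLaw (fun _ : Fin T => A) U ψ {a | |a - θ| ≤ ε} := by
  have := A.isProbabilityMeasure_outputLaw U hψ
  set μ := A.outputLaw U ψ with hμ
  set ν : Measure (Fin T → ℝ) := Measure.pi fun _ => μ with hν
  have hmem : ∀ i : Fin T, MemLp (fun y : Fin T → ℝ => y i) 2 ν := fun i =>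
    (A.memLp_id_outputLaw U hψ).comp_measurePreserving (measurePreserving_eval (fun _ => μ) i)
  have hT' : (0 : ℝ) < T := by exact_mod_cast hT
  set X : (Fin T → ℝ) → ℝ := fun y => (T : ℝ)⁻¹ * ∑ i, y i with hX
  have hXm : Measurable X := by fun_prop
  have hsum : MemLp (fun y : Fin T → ℝ => ∑ i, y i) 2 ν := memLp_finsetSum _ fun i _ => hmem i
  have hXmem : MemLp X 2 ν := hsum.const_mul _
  have hmean : ∫ y, X y ∂ν = ∫ y, y ∂μ := by
    rw [hX, integral_const_mul, integral_finsetSum]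
    · have : ∀ i : Fin T, ∫ y : Fin T → ℝ, y i ∂ν = ∫ y, y ∂μ := fun i =>
        integral_comp_eval (μ := fun _ : Fin T => μ) (f := fun y : ℝ => y) aestronglyMeasurable_id
      simp only [this, Finset.sum_const, Finset.card_univ, Fintype.card_fin, nsmul_eq_mul]
      field_simp
    · exact fun i _ => (hmem i).integrable (by norm_num)
  have hvarX : ProbabilityTheory.variance X ν = (T : ℝ)⁻¹ * ProbabilityTheory.variance id μ := by
    rw [hX, ProbabilityTheory.variance_const_mul]
    have h := ProbabilityTheory.variance_sum_pi (μ := fun _ : Fin T => μ)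
      (X := fun _ => (id : ℝ → ℝ)) fun i => A.memLp_id_outputLaw U hψ
    have e : (∑ i : Fin T, fun ω : Fin T → ℝ => id (ω i)) = fun y => ∑ i, y i := by
      ext y; simp
    rw [e] at h
    rw [h]
    simp only [Finset.sum_const, Finset.card_univ, Fintype.card_fin, nsmul_eq_mul]
    field_simp
  have hcheb := ProbabilityTheory.meas_ge_le_variance_div_sq hXmem
    (show (0 : ℝ) < 0.95 * ε by positivity)
  rw [hmean, hvarX] at hcheb
  -- `(4/9) / 0.95² ≈ 0.49246`, just below one half.
  have hle : (T : ℝ)⁻¹ * ProbabilityTheory.variance id μ / (0.95 * ε) ^ 2 ≤ 0.4925 := by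
    rw [div_le_iff₀ (by positivity), inv_mul_le_iff₀ hT']
    have : 0 < ε ^ 2 * T := by positivity
    nlinarith
  have hbad : ν {y | 0.95 * ε ≤ |X y - ∫ y, y ∂μ|} ≤ ENNReal.ofReal 0.4925 :=
    hcheb.trans (ENNReal.ofReal_le_ofReal hle)
  have hms : MeasurableSet {a : ℝ | |a - θ| ≤ ε} :=
    measurableSet_le (by fun_prop) measurable_const
  have hmB : MeasurableSet {y | 0.95 * ε ≤ |X y - ∫ y, y ∂μ|} :=
    measurableSet_le measurable_const (by fun_prop)
  have hXe : (fun y : Fin T → ℝ => (∑ i, y i) / (T : ℝ)) = X := by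
    ext y; rw [hX, div_eq_inv_mul]
  have hlaw : sampleMeanLaw (fun _ : Fin T => A) U ψ = ν.map X := by
    rw [← hXe]; rfl
  rw [hlaw, Measure.map_apply hXm hms]
  have hsub : {y | 0.95 * ε ≤ |X y - ∫ y, y ∂μ|}ᶜ ⊆ X ⁻¹' {a : ℝ | |a - θ| ≤ ε} := by
    intro y hy
    simp only [Set.mem_compl_iff, Set.mem_ofPred_eq, not_le, Set.mem_preimage] at hy ⊢
    have := abs_add_le (X y - ∫ y, y ∂μ) ((∫ y, y ∂μ) - θ)
    rw [sub_add_sub_cancel] at this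
    linarith
  refine lt_of_lt_of_le ?_ (measure_mono hsub)
  rw [prob_compl_eq_one_sub hmB]
  refine lt_of_lt_of_le ?_ (tsub_le_tsub_left hbad 1)
  rw [show (1 / 2 : ENNReal) = ENNReal.ofReal (1 / 2) by
    rw [ENNReal.ofReal_div_of_pos two_pos]; simp]
  rw [← ENNReal.ofReal_one, ← ENNReal.ofReal_sub _ (by norm_num)]
  exact (ENNReal.ofReal_lt_ofReal_iff (by norm_num)).2 (by norm_num)

theorem one_le_sqrt_three_mul_rpow {β ε : ℝ} (hβ : β ≤ 1) (hε : 0 < ε) (hε₁ : ε < 1) :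
    1 ≤ √3 * ε ^ (-1 + β) := by
  have h1 : (1 : ℝ) ≤ √3 := Real.one_le_sqrt.2 (by norm_num)
  have h2 : 1 ≤ ε ^ (-1 + β) :=
    Real.one_le_rpow_of_pos_of_le_one_of_nonpos hε hε₁.le (by linarith)
  nlinarith

theorem lowDepthRuns_accurate {A : (n : ℕ) → ℝ → ℝ → QueryAlgorithm n}
    (hA : IsUnbiasedPhaseEstimation A) {β ε : ℝ} (hβ1 : β ≤ 1) (hε : 0 < ε)
    (hε1 : ε < 1) {n : ℕ} (U : Matrix.unitaryGroup (Fin n) ℂ) {ψ : EuclideanSpace ℂ (Fin n)}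
    {θ : ℝ} (h : IsPhaseInstance U ψ θ) :
    1 / 2 < sampleMeanLaw (lowDepthRuns A n β ε) U ψ {a | |a - θ| ≤ ε} := by
  set K := √3 * ε ^ (-1 + β) with hK
  set B := min (1 / 9 * ε ^ (2 - 2 * β)) (0.05 * ε) with hB
  have hK1 : 1 ≤ K := one_le_sqrt_three_mul_rpow hβ1 hε hε1
  have hB0 : 0 < B := lt_min (by positivity) (by positivity)
  have hBε : B ≤ 0.05 * ε := min_le_right _ _
  have hB1 : B < 1 := by linarith
  have hTpos : 0 < ε ^ (-2 * β) := by positivity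
  refine sampleMeanLaw_const_gt_half (Nat.ceil_pos.2 hTpos) (A n K B) U h.1 hε
    ((hA.bias n K B hK1 hB0 hB1 U ψ θ h).trans hBε)
    ((hA.variance n K B hK1 hB0 hB1 U ψ θ h).trans ?_)
  -- The variance budget `4/9` is `1/3` from `1 / K ^ 2` plus `1/9` from the first term of the
  -- minimum defining `B`; the remaining factor `ε ^ (-2 * β)` is at most the number of runs.
  have hKsq : 1 / K ^ 2 = 1 / 3 * ε ^ (2 - 2 * β) := by
    rw [hK, mul_pow, Real.sq_sqrt (by norm_num), ← Real.rpow_natCast, ← Real.rpow_mul hε.le,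
      one_div, mul_inv, ← Real.rpow_neg hε.le]
    norm_num
    ring_nf
  have hεsq : ε ^ (2 - 2 * β) = ε ^ 2 * ε ^ (-2 * β) := by
    rw [← Real.rpow_natCast, ← Real.rpow_add hε]
    norm_num
    ring_nf
  have hceil := Nat.le_ceil (ε ^ (-2 * β))
  have hmul := mul_le_mul_of_nonneg_left hceil (show 0 ≤ 4 / 9 * ε ^ 2 by positivity)
  have := min_le_left (1 / 9 * ε ^ (2 - 2 * β)) (0.05 * ε)
  rw [← hB] at this
  rw [hKsq]
  rw [hεsq] at this ⊢
  linarith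

/-- Uniformly in `β`, the numerator is at most `2 / ε` and the denominator at least `ε² / 20`, so
the ratio is at most `40 / ε³`. -/
theorem log_ratio_le {β ε : ℝ} (hβ0 : 0 ≤ β) (hε : 0 < ε) (hε1 : ε < 1) :
    Real.log (√3 * ε ^ (-1 + β) / min (1 / 9 * ε ^ (2 - 2 * β)) (0.05 * ε)) ≤
      Real.log 40 + 3 * Real.log (1 / ε) := by
  have hB : 1 / 20 * ε ^ (2 : ℝ) ≤ min (1 / 9 * ε ^ (2 - 2 * β)) (0.05 * ε) := by
    have h1 : ε ^ (2 : ℝ) ≤ ε ^ (2 - 2 * β) :=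
      Real.rpow_le_rpow_of_exponent_ge hε hε1.le (by linarith)
    have h2 : ε ^ (2 : ℝ) ≤ ε := by
      simpa using Real.rpow_le_rpow_of_exponent_ge hε hε1.le (show (1 : ℝ) ≤ 2 by norm_num)
    have h3 : 0 < ε ^ (2 - 2 * β) := by positivity
    refine le_min ?_ ?_ <;> linarith
  have hK : √3 * ε ^ (-1 + β) ≤ 2 * ε ^ (-1 : ℝ) := by
    have h1 : √3 ≤ 2 := Real.sqrt_le_iff.2 ⟨by norm_num, by norm_num⟩
    have h2 : ε ^ (-1 + β) ≤ ε ^ (-1 : ℝ) :=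
      Real.rpow_le_rpow_of_exponent_ge hε hε1.le (by linarith)
    gcongr
  have hdiv : √3 * ε ^ (-1 + β) / min (1 / 9 * ε ^ (2 - 2 * β)) (0.05 * ε) ≤
      40 * (1 / ε) ^ 3 := by
    refine (div_le_div₀ (by positivity) hK (by positivity) hB).trans (le_of_eq ?_)
    rw [Real.rpow_neg_one, Real.rpow_two]
    field_simp
    norm_num
  have hpos : 0 < min (1 / 9 * ε ^ (2 - 2 * β)) (0.05 * ε) :=
    lt_min (by positivity) (by positivity)
  refine (Real.log_le_log (by positivity) hdiv).trans (le_of_eq ?_)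
  rw [Real.log_mul (by norm_num) (by positivity), Real.log_pow]
  norm_num

theorem lowDepthRuns_resources {A : (n : ℕ) → ℝ → ℝ → QueryAlgorithm n}
    (hA : IsUnbiasedPhaseEstimation A) {ε₁ : ℝ} (hε₁ : ε₁ < 1) :
    ∃ C : ℝ, ∀ β ε : ℝ, 0 ≤ β → β ≤ 1 → 0 < ε → ε ≤ ε₁ → ∀ n : ℕ,
      (parallelDepth (lowDepthRuns A n β ε) : ℝ) ≤ C * (ε ^ (-1 + β) * Real.log (1 / ε)) ∧
      (totalQueries (lowDepthRuns A n β ε) : ℝ) ≤ C * (ε ^ (-1 - β) * Real.log (1 / ε)) := by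
  obtain ⟨C₀, hC₀⟩ := hA.queries_le (1 / 2) (by norm_num)
  -- Keeping `ε` below `ε₁ < 1` keeps `log (1 / ε)` away from zero, so the additive `log 40` is
  -- absorbed into a multiple of it.
  set c := Real.log 40 / Real.log (1 / ε₁) + 3 with hc
  set D := |C₀| * √3 * c with hD
  refine ⟨2 * D, fun β ε hβ0 hβ1 hε hεle n => ?_⟩
  have hε1 : ε < 1 := hεle.trans_lt hε₁
  have hε₁0 : 0 < ε₁ := hε.trans_le hεle
  set K := √3 * ε ^ (-1 + β) with hK
  set B := min (1 / 9 * ε ^ (2 - 2 * β)) (0.05 * ε) with hB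
  have hK1 : 1 ≤ K := one_le_sqrt_three_mul_rpow hβ1 hε hε1
  have hB0 : 0 < B := lt_min (by positivity) (by positivity)
  have hBε : B ≤ 0.05 * ε := min_le_right _ _
  have hlog₁ : 0 < Real.log (1 / ε₁) := Real.log_pos (by rw [lt_div_iff₀ hε₁0]; linarith)
  have hlogle : Real.log (1 / ε₁) ≤ Real.log (1 / ε) :=
    Real.log_le_log (by positivity) (by gcongr)
  have hl40 : 0 < Real.log 40 := Real.log_pos (by norm_num)
  have hc0 : 0 ≤ c := by positivity
  have hD0 : 0 ≤ D := by positivity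
  have hlog : Real.log (K / B) ≤ c * Real.log (1 / ε) := by
    refine (log_ratio_le hβ0 hε hε1).trans ?_
    rw [hc, add_mul]
    gcongr
    rw [div_mul_eq_mul_div, le_div_iff₀ hlog₁]
    gcongr
  have hlog0 : 0 ≤ Real.log (K / B) :=
    Real.log_nonneg (by rw [le_div_iff₀ hB0]; linarith)
  set E := ε ^ (-1 + β) * Real.log (1 / ε) with hE
  have hE0 : 0 ≤ E := mul_nonneg (by positivity) (hlog₁.le.trans hlogle)
  have hq : ((A n K B).queries : ℝ) ≤ D * E := by
    calc ((A n K B).queries : ℝ) ≤ C₀ * (K * Real.log (K / B)) :=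
          hC₀ n K B hK1 hB0 (by linarith)
      _ ≤ |C₀| * (K * Real.log (K / B)) := by gcongr; exact le_abs_self _
      _ ≤ |C₀| * (K * (c * Real.log (1 / ε))) := by gcongr
      _ = D * E := by rw [hD, hE, hK]; ring
  have hruns : ∀ i, (lowDepthRuns A n β ε i).queries = (A n K B).queries := fun _ => rfl
  constructor
  · have : parallelDepth (lowDepthRuns A n β ε) ≤ (A n K B).queries :=
      Finset.sup_le fun i _ => (hruns i).le
    have h2 : (parallelDepth (lowDepthRuns A n β ε) : ℝ) ≤ ((A n K B).queries : ℝ) := by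
      exact_mod_cast this
    have := mul_nonneg hD0 hE0
    linarith
  -- The power is at least one, so rounding up at most doubles it; this is the factor 2 in the
  -- constant.
  · have hT : (⌈ε ^ (-2 * β)⌉₊ : ℝ) ≤ 2 * ε ^ (-2 * β) := by
      have h1 : 1 ≤ ε ^ (-2 * β) :=
        Real.one_le_rpow_of_pos_of_le_one_of_nonpos hε hε1.le (by linarith)
      have := Nat.ceil_lt_add_one (show 0 ≤ ε ^ (-2 * β) by positivity)
      linarith
    have hsum : (totalQueries (lowDepthRuns A n β ε) : ℝ) =
        ⌈ε ^ (-2 * β)⌉₊ * ((A n K B).queries : ℝ) := by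
      rw [totalQueries, Finset.sum_congr rfl fun i _ => hruns i, Finset.sum_const,
        Finset.card_univ, Fintype.card_fin, smul_eq_mul, Nat.cast_mul]
    have hpow : ε ^ (-1 - β) = ε ^ (-2 * β) * ε ^ (-1 + β) := by
      rw [← Real.rpow_add hε]; ring_nf
    rw [hsum, hpow]
    calc (⌈ε ^ (-2 * β)⌉₊ : ℝ) * ((A n K B).queries : ℝ)
        ≤ (2 * ε ^ (-2 * β)) * (D * E) := by gcongr
      _ = _ := by rw [hE]; ring

/-! ### The phase kickback circuit -/

/-- A unit vector extends to an orthonormal basis, whose coordinate matrix is unitary. This provides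
the state preparation gate. -/
theorem exists_unitary_col {ι : Type*} [Fintype ι] [DecidableEq ι] (i₀ : ι) (a : ι → ℂ)
    (ha : ∑ i, ‖a i‖ ^ 2 = 1) : ∃ V : Matrix.unitaryGroup ι ℂ, ∀ i, V.val i i₀ = a i := by
  have hnorm : ‖(WithLp.toLp 2 a : EuclideanSpace ℂ ι)‖ = 1 := by
    rw [EuclideanSpace.norm_eq]
    simp [ha]
  have horth : Orthonormal ℂ
      (({i₀} : Set ι).domRestrict fun _ => (WithLp.toLp 2 a : EuclideanSpace ℂ ι)) := by
    refine ⟨fun _ => hnorm, fun i j hij => ?_⟩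
    exact absurd (Subsingleton.elim i j) hij
  obtain ⟨b, hb⟩ := horth.exists_orthonormalBasis_extension_of_card_eq (by simp)
  refine ⟨⟨_, (EuclideanSpace.basisFun ι ℂ).toMatrix_orthonormalBasis_mem_unitary b⟩,
    fun i => ?_⟩
  simp [Module.Basis.toMatrix_apply, hb i₀ rfl]

theorem kronecker_mulVec_mul {ι κ : Type*} [Fintype ι] [Fintype κ] (F : Matrix ι ι ℂ)
    (G : Matrix κ κ ℂ) (α : ι → ℂ) (β : κ → ℂ) :
    (Matrix.kroneckerMap (· * ·) F G).mulVec (fun x => α x.1 * β x.2) =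
      fun x => F.mulVec α x.1 * G.mulVec β x.2 := by
  ext x
  simp only [Matrix.mulVec, dotProduct, Matrix.kroneckerMap_apply, Fintype.sum_prod_type,
    Finset.sum_mul_sum]
  exact Finset.sum_congr rfl fun i _ => Finset.sum_congr rfl fun j _ => by ring

/-- The tensor product of two unitary matrices. -/
def unitaryKronecker {ι κ : Type*} [Fintype ι] [Fintype κ] [DecidableEq ι] [DecidableEq κ]
    (F : Matrix.unitaryGroup ι ℂ) (G : Matrix.unitaryGroup κ ℂ) :
    Matrix.unitaryGroup (ι × κ) ℂ :=
  ⟨Matrix.kroneckerMap (· * ·) F.val G.val, Matrix.kronecker_mem_unitary F.2 G.2⟩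

/-- The unitary matrix of a permutation of the basis vectors. -/
def permUnitary {ι : Type*} [Fintype ι] [DecidableEq ι] (σ : Equiv.Perm ι) :
    Matrix.unitaryGroup ι ℂ :=
  ⟨σ.permMatrix ℂ, by
    rw [Matrix.mem_unitaryGroup_iff', Matrix.star_eq_conjTranspose,
      Matrix.conjTranspose_permMatrix, ← Matrix.permMatrix_mul, mul_inv_cancel,
      Matrix.permMatrix_one]⟩

theorem permUnitary_mulVec {ι : Type*} [Fintype ι] [DecidableEq ι] (σ : Equiv.Perm ι)
    (v : ι → ℂ) : (permUnitary σ).val.mulVec v = v ∘ σ :=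
  Matrix.permMatrix_mulVec σ

/-- The permutation of the basis of the memory that flips the control qubit where `p` holds on
the workspace. -/
def controlFlip {w n : ℕ} (p : Fin w → Bool) : Equiv.Perm (Fin w × Bool × Fin n) where
  toFun x := (x.1, xor (p x.1) x.2.1, x.2.2)
  invFun x := (x.1, xor (p x.1) x.2.1, x.2.2)
  left_inv x := by simp
  right_inv x := by simp

/-- The algorithm that prepares the workspace in the column `i₀` of `V`, lets the basis state `k`
acquire the phase of the unknown unitary `k + 1` times (for `k < M`), and measures the workspace
after the unitary `F`. -/
def phaseAlgorithm (n : ℕ) {W : ℕ} (M : ℕ) (i₀ : Fin W) (V F : Matrix.unitaryGroup (Fin W) ℂ)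
    (y : Fin W → ℝ) : QueryAlgorithm n where
  w := W
  init := i₀
  first := permUnitary (controlFlip fun _ => true) * unitaryKronecker V 1
  steps := (List.range M).map (fun j => (false, permUnitary (controlFlip fun k => k.val == j))) ++
    [(false, unitaryKronecker F 1)]
  output x := y x.1

theorem queries_phaseAlgorithm {n W M : ℕ} (i₀ : Fin W) (V F : Matrix.unitaryGroup (Fin W) ℂ)
    (y : Fin W → ℝ) : (phaseAlgorithm n M i₀ V F y).queries = M + 1 :=
  List.length_append.trans
    (congrArg (· + 1) ((List.length_map _).trans List.length_range))

/-- The state of the memory of `phaseAlgorithm` after `j` rounds. -/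
def roundState {W n : ℕ} (a : Fin W → ℂ) (z : ℂ) (ψ : Fin n → ℂ) (j : ℕ) :
    Fin W × Bool × Fin n → ℂ :=
  fun x => if x.2.1 = decide (j ≤ x.1.val) then a x.1 * z ^ min j (x.1.val + 1) * ψ x.2.2 else 0

/-- In round `j` the control is on exactly for the branches `k ≥ j`. The query multiplies these by
`z`, and the flip then retires branch `k = j`, which has gathered `z ^ (k + 1)`. -/
theorem roundState_succ {W n : ℕ} (a : Fin W → ℂ) (z : ℂ) {ψ : Fin n → ℂ}
    {U : Matrix (Fin n) (Fin n) ℂ} (hU : U.mulVec ψ = z • ψ) (j : ℕ) :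
    (permUnitary (controlFlip fun k => k.val == j)).val.mulVec
      (controlledApply U (roundState a z ψ j)) = roundState a z ψ (j + 1) := by
  have hlin : ∀ c : ℂ, (U.mulVec fun s => c * ψ s) = fun s => c * (z * ψ s) := by
    intro c
    have : (fun s => c * ψ s) = c • ψ := rfl
    rw [this, Matrix.mulVec_smul, hU]
    rfl
  -- Between query and flip the exponent has advanced to `j + 1` but the control still reads `j`;
  -- for retired branches the minimum is already saturated.
  have hctrl : controlledApply U (roundState a z ψ j) = fun x =>
      if x.2.1 = decide (j ≤ x.1.val) then
        a x.1 * z ^ min (j + 1) (x.1.val + 1) * ψ x.2.2 else 0 := by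
    ext ⟨x, b, s⟩
    simp only [controlledApply, roundState]
    cases b
    · by_cases h : j ≤ x.val
      · simp [h]
      · have h1 : min j (x.val + 1) = min (j + 1) (x.val + 1) := by omega
        simp [h, h1]
    · by_cases h : j ≤ x.val
      · have h1 : min j (x.val + 1) = j := by omega
        have h2 : min (j + 1) (x.val + 1) = j + 1 := by omega
        simp only [h, decide_true, if_true, hlin, h1, h2]
        ring
      · simp [h, Matrix.mulVec, dotProduct]
  rw [permUnitary_mulVec, hctrl]
  ext ⟨x, b, s⟩
  simp only [Function.comp, controlFlip, Equiv.coe_fn_mk, roundState]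
  congr 1
  rcases lt_trichotomy x.val j with h | h | h
  · have h1 : ¬ j ≤ x.val := by omega
    have h2 : ¬ j + 1 ≤ x.val := by omega
    have h3 : (x.val == j) = false := beq_false_of_ne (by omega)
    simp [h1, h2, h3]
  · simp [h]
  · have h1 : j ≤ x.val := by omega
    have h2 : j + 1 ≤ x.val := by omega
    have h3 : (x.val == j) = false := beq_false_of_ne (by omega)
    simp [h1, h2, h3]

theorem finalState_phaseAlgorithm {n W M : ℕ} (i₀ : Fin W) (V F : Matrix.unitaryGroup (Fin W) ℂ)
    (y : Fin W → ℝ) (hV : ∀ k : Fin W, M ≤ k.val → V.val k i₀ = 0)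
    {U : Matrix.unitaryGroup (Fin n) ℂ} {ψ : EuclideanSpace ℂ (Fin n)} {z : ℂ}
    (hU : U.val.mulVec ψ.ofLp = z • ψ.ofLp) (x : Fin W × Bool × Fin n) :
    (phaseAlgorithm n M i₀ V F y).finalState U ψ x =
      F.val.mulVec (fun k => V.val k i₀ * z ^ (k.val + 1)) x.1 *
        (if x.2.1 = false then ψ x.2.2 else 0) := by
  set β : Bool × Fin n → ℂ := fun c => if c.1 = false then ψ c.2 else 0 with hβ
  have hinit : (fun x : Fin W × Bool × Fin n =>
        if x.1 = i₀ ∧ x.2.1 = false then ψ x.2.2 else 0) =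
      fun x => (Pi.single i₀ (1 : ℂ) : Fin W → ℂ) x.1 * β x.2 := by
    ext ⟨k, b, s⟩
    by_cases hk : k = i₀
    · subst hk
      simp [hβ]
    · simp [hk]
  have hfirst : (permUnitary (controlFlip fun _ => true) *
        unitaryKronecker V (1 : Matrix.unitaryGroup (Bool × Fin n) ℂ)).val.mulVec
      (fun x : Fin W × Bool × Fin n => if x.1 = i₀ ∧ x.2.1 = false then ψ x.2.2 else 0) =
        roundState (fun k => V.val k i₀) z ψ.ofLp 0 := by
    rw [hinit, Submonoid.coe_mul, ← Matrix.mulVec_mulVec]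
    change (permUnitary (controlFlip fun _ => true)).val.mulVec
      ((Matrix.kroneckerMap (· * ·) V.val (1 : Matrix (Bool × Fin n) (Bool × Fin n) ℂ)).mulVec _) = _
    rw [kronecker_mulVec_mul, permUnitary_mulVec]
    ext ⟨k, b, s⟩
    cases b <;> simp [controlFlip, roundState, hβ]
  have hrounds : ∀ j, ((List.range j).map fun j =>
      (false, permUnitary (controlFlip (n := n) fun k : Fin W => k.val == j))).foldl
        (fun φ st => st.2.val.mulVec
          (controlledApply (if st.1 = true then (U⁻¹).val else U.val) φ))
        (roundState (fun k => V.val k i₀) z ψ.ofLp 0) =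
      roundState (fun k => V.val k i₀) z ψ.ofLp j := by
    intro j
    induction j with
    | zero => rfl
    | succ j ih =>
      rw [List.range_succ, List.map_append, List.foldl_append, ih]
      exact roundState_succ _ z hU j
  -- After `M` rounds only branches `k ≥ M` still have the control on, and their amplitude vanishes,
  -- so the workspace is no longer entangled with the rest.
  have hM : roundState (fun k => V.val k i₀) z ψ.ofLp M =
      fun x => (V.val x.1 i₀ * z ^ (x.1.val + 1)) * β x.2 := by
    ext ⟨k, b, s⟩
    by_cases hk : M ≤ k.val
    · simp [roundState, hV k hk]
    · have : min M (k.val + 1) = k.val + 1 := by omega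
      cases b <;> simp [roundState, hβ, hk, this]
  -- The control is now off everywhere, so the last query acts trivially; it only precedes the gate
  -- `F`.
  have hlast : controlledApply U.val (fun x : Fin W × Bool × Fin n =>
      (V.val x.1 i₀ * z ^ (x.1.val + 1)) * β x.2) =
      fun x => (V.val x.1 i₀ * z ^ (x.1.val + 1)) * β x.2 := by
    ext ⟨k, b, s⟩
    cases b <;> simp [controlledApply, hβ, Matrix.mulVec, dotProduct]
  have hgate : ((((List.range M).map fun j =>
      (false, permUnitary (controlFlip (n := n) fun k : Fin W => k.val == j))) ++
        [(false, unitaryKronecker F 1)]).foldl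
        (fun (φ : Fin W × Bool × Fin n → ℂ)
            (st : Bool × Matrix.unitaryGroup (Fin W × Bool × Fin n) ℂ) => st.2.val.mulVec
          (controlledApply (if st.1 = true then (U⁻¹).val else U.val) φ))
        ((permUnitary (controlFlip fun _ => true) *
          unitaryKronecker V (1 : Matrix.unitaryGroup (Bool × Fin n) ℂ)).val.mulVec
          (fun x : Fin W × Bool × Fin n =>
            if x.1 = i₀ ∧ x.2.1 = false then ψ x.2.2 else 0)) : Fin W × Bool × Fin n → ℂ) =
      (Matrix.kroneckerMap (· * ·) F.val (1 : Matrix (Bool × Fin n) (Bool × Fin n) ℂ)).mulVec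
        (controlledApply U.val (fun x : Fin W × Bool × Fin n =>
          (V.val x.1 i₀ * z ^ (x.1.val + 1)) * β x.2)) := by
    rw [hfirst, List.foldl_append, hrounds, hM]
    rfl
  rw [hlast, kronecker_mulVec_mul (α := fun k => V.val k i₀ * z ^ (k.val + 1)),
    Matrix.one_mulVec] at hgate
  exact congrFun hgate x

theorem integral_outputLaw_phaseAlgorithm {n W M : ℕ} (i₀ : Fin W)
    (V F : Matrix.unitaryGroup (Fin W) ℂ)
    (y : Fin W → ℝ) (hV : ∀ k : Fin W, M ≤ k.val → V.val k i₀ = 0)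
    {U : Matrix.unitaryGroup (Fin n) ℂ} {ψ : EuclideanSpace ℂ (Fin n)} (hψ : ‖ψ‖ = 1) {z : ℂ}
    (hU : U.val.mulVec ψ.ofLp = z • ψ.ofLp) (f : ℝ → ℝ) :
    ∫ t, f t ∂((phaseAlgorithm n M i₀ V F y).outputLaw U ψ) =
      ∑ x, ‖F.val.mulVec (fun k => V.val k i₀ * z ^ (k.val + 1)) x‖ ^ 2 * f (y x) := by
  have key : ∫ t, f t ∂((phaseAlgorithm n M i₀ V F y).outputLaw U ψ) =
      ∑ x : Fin W × Bool × Fin n, ‖F.val.mulVec (fun k => V.val k i₀ * z ^ (k.val + 1)) x.1 *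
        (if x.2.1 = false then ψ x.2.2 else 0)‖ ^ 2 * f (y x.1) := by
    rw [QueryAlgorithm.integral_outputLaw]
    exact Finset.sum_congr rfl fun x _ =>
      congrArg (fun c => ‖c‖ ^ 2 * f (y x.1)) (finalState_phaseAlgorithm i₀ V F y hV hU x)
  rw [key]
  simp only [Fintype.sum_prod_type, Fintype.sum_bool]
  refine Finset.sum_congr rfl fun k _ => ?_
  simp only [Bool.true_eq_false, if_false, if_true, mul_zero, norm_zero, norm_mul, mul_pow]
  norm_num
  rw [← Finset.sum_mul, ← Finset.mul_sum, sum_norm_sq_eq_one hψ, mul_one]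

/-! ### Characters and geometric sums -/

/-- The character `t ↦ e^{2πit}`. -/
def phase (t : ℝ) : ℂ := Complex.exp (2 * Real.pi * Complex.I * t)

theorem phase_add (s t : ℝ) : phase (s + t) = phase s * phase t := by
  rw [phase, phase, phase, ← Complex.exp_add]
  push_cast
  ring_nf

theorem phase_eq_exp_I_mul (t : ℝ) :
    phase t = Complex.exp (Complex.I * ((2 * Real.pi * t : ℝ) : ℂ)) := by
  rw [phase]
  push_cast
  ring_nf

theorem norm_phase (t : ℝ) : ‖phase t‖ = 1 := by
  rw [phase_eq_exp_I_mul, mul_comm, Complex.norm_exp_ofReal_mul_I]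

theorem conj_phase (t : ℝ) : (starRingEnd ℂ) (phase t) = phase (-t) := by
  rw [phase_eq_exp_I_mul, phase_eq_exp_I_mul, ← Complex.exp_conj, map_mul, Complex.conj_I,
    Complex.conj_ofReal]
  push_cast
  ring_nf

theorem phase_nat_mul (k : ℕ) (t : ℝ) : phase (k * t) = phase t ^ k := by
  rw [phase, phase, ← Complex.exp_nat_mul]
  push_cast
  ring_nf

theorem phase_int (k : ℤ) : phase k = 1 := by
  rw [phase, Complex.exp_eq_one_iff]
  exact ⟨k, by push_cast; ring⟩

theorem norm_phase_sub_one (t : ℝ) : ‖phase t - 1‖ = 2 * |Real.sin (Real.pi * t)| := by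
  rw [phase_eq_exp_I_mul, Complex.norm_exp_I_mul_ofReal_sub_one, Real.norm_eq_abs, abs_mul,
    abs_two]
  congr 3
  ring

theorem norm_phase_sub_phase_le (s t : ℝ) : ‖phase s - phase t‖ ≤ 2 * Real.pi * |s - t| := by
  have h : phase s - phase t = phase t * (phase (s - t) - 1) := by
    rw [mul_sub, ← phase_add, add_sub_cancel, mul_one]
  rw [h, norm_mul, norm_phase, one_mul, phase_eq_exp_I_mul]
  refine Real.norm_exp_I_mul_ofReal_sub_one_le.trans (le_of_eq ?_)
  rw [Real.norm_eq_abs, abs_mul, abs_of_pos Real.two_pi_pos]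

/-- Jordan's inequality `sin (π u) ≥ 2u` on `[0, 1/2]`, carried to `[1/2, 1]` by the symmetry of the
sine about `π / 2`. -/
theorem two_mul_le_sin_pi_mul {δ t : ℝ} (hδ : 0 ≤ δ) (h1 : δ ≤ |t|) (h2 : |t| ≤ 1 - δ) :
    2 * δ ≤ |Real.sin (Real.pi * t)| := by
  have habs : |Real.sin (Real.pi * t)| = Real.sin (Real.pi * |t|) := by
    rcases abs_cases t with ⟨h, h0⟩ | ⟨h, h0⟩
    · rw [h, abs_of_nonneg]
      exact Real.sin_nonneg_of_nonneg_of_le_pi (by positivity)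
        (by nlinarith [Real.pi_pos])
    · rw [h, mul_neg, Real.sin_neg, abs_of_nonpos]
      have := Real.sin_nonneg_of_nonneg_of_le_pi (x := Real.pi * -t)
        (by nlinarith [Real.pi_pos]) (by nlinarith [Real.pi_pos])
      rw [mul_neg, Real.sin_neg] at this
      linarith
  rw [habs]
  have key : ∀ u : ℝ, δ ≤ u → u ≤ 1 / 2 → 2 * δ ≤ Real.sin (Real.pi * u) := by
    intro u hu hu2
    have := Real.mul_le_sin (x := Real.pi * u) (by nlinarith [Real.pi_pos])
      (by nlinarith [Real.pi_pos])
    have h3 : 2 / Real.pi * (Real.pi * u) = 2 * u := by field_simp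
    linarith
  rcases le_total |t| (1 / 2) with h | h
  · exact key _ h1 h
  · have := key (1 - |t|) (by linarith) (by linarith)
    rwa [mul_sub, mul_one, Real.sin_pi_sub] at this

/-- The sum times `1 - w` is `1 - w ^ m`, of norm at most 2, while `‖1 - w‖ = 2 |sin (π t)| ≥ 4 /
m`. -/
theorem norm_geom_sum_phase_le {m : ℕ} (hm : 0 < m) {t : ℝ} (h1 : 1 / (m : ℝ) ≤ |t|)
    (h2 : |t| ≤ 1 - 1 / (m : ℝ)) : ‖∑ i ∈ Finset.range m, phase t ^ i‖ ≤ m / 2 := by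
  have hm' : (0 : ℝ) < m := by exact_mod_cast hm
  have hsin := two_mul_le_sin_pi_mul (by positivity) h1 h2
  have hgeom := congrArg norm (mul_neg_geom_sum (phase t) m)
  rw [norm_mul, norm_sub_rev, norm_phase_sub_one] at hgeom
  have hle : ‖1 - phase t ^ m‖ ≤ 2 := by
    refine (norm_sub_le _ _).trans ?_
    rw [norm_pow, norm_phase, norm_one, one_pow]
    norm_num
  rw [← hgeom] at hle
  have h4 : 2 * (2 * (1 / (m : ℝ))) * ‖∑ i ∈ Finset.range m, phase t ^ i‖ ≤ 2 :=
    le_trans (by gcongr) hle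
  have h5 : 2 * (2 * (1 / (m : ℝ))) * ‖∑ i ∈ Finset.range m, phase t ^ i‖ =
      4 * ‖∑ i ∈ Finset.range m, phase t ^ i‖ / m := by ring
  rw [h5, div_le_iff₀ hm'] at h4
  linarith

/-! ### Concentrated amplitudes and their error density -/

/-- Normalized amplitudes whose generating function is a multiple of `(1 + z + ⋯ + z^(m-1))^L`. -/
theorem exists_concentrated_amplitudes {m : ℕ} (hm : 0 < m) (L : ℕ) :
    ∃ a : ℕ → ℝ, (∀ k, (m - 1) * L + 1 ≤ k → a k = 0) ∧
      ∑ k ∈ Finset.range ((m - 1) * L + 1), a k ^ 2 = 1 ∧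
      ∀ z : ℂ, ‖∑ k ∈ Finset.range ((m - 1) * L + 1), (a k : ℂ) * z ^ k‖ ^ 2 ≤
        (((m - 1) * L + 1 : ℕ) : ℝ) * (‖∑ i ∈ Finset.range m, z ^ i‖ / m) ^ (2 * L) := by
  set M := (m - 1) * L + 1 with hM
  set P : Polynomial ℝ := (∑ i ∈ Finset.range m, Polynomial.X ^ i) ^ L with hP
  have hm' : (0 : ℝ) < m := by exact_mod_cast hm
  have hdeg : P.natDegree < M := by
    have h1 : (∑ i ∈ Finset.range m, (Polynomial.X : Polynomial ℝ) ^ i).natDegree ≤ m - 1 := by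
      refine Polynomial.natDegree_sum_le_of_forall_le _ _ fun i hi => ?_
      have := Finset.mem_range.1 hi
      rw [Polynomial.natDegree_X_pow]
      omega
    have h2 := Polynomial.natDegree_pow_le_of_le L h1
    rw [mul_comm, ← hP] at h2
    omega
  have heval1 : ∑ k ∈ Finset.range M, P.coeff k = (m : ℝ) ^ L := by
    have := Polynomial.eval_eq_sum_range' hdeg 1
    simp only [one_pow, mul_one] at this
    rw [← this, hP, Polynomial.eval_pow, Polynomial.eval_finsetSum]
    simp
  have heval : ∀ z : ℂ, ∑ k ∈ Finset.range M, (P.coeff k : ℂ) * z ^ k =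
      (∑ i ∈ Finset.range m, z ^ i) ^ L := by
    intro z
    have h1 := Polynomial.eval₂_eq_sum_range' (algebraMap ℝ ℂ) hdeg z
    have h2 : P.eval₂ (algebraMap ℝ ℂ) z = (∑ i ∈ Finset.range m, z ^ i) ^ L := by
      rw [hP, Polynomial.eval₂_pow, Polynomial.eval₂_finsetSum]
      simp
    rw [← h2, h1]
    rfl
  set N := ∑ k ∈ Finset.range M, P.coeff k ^ 2 with hN
  -- Cauchy–Schwarz applied to `P(1) = m ^ L` bounds the normalization `N` from below; this is the
  -- source of the factor `M` in the estimate.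
  have hCS : ((m : ℝ) ^ L) ^ 2 ≤ M * N := by
    have := sq_sum_le_card_mul_sum_sq (s := Finset.range M) (f := P.coeff)
    rwa [heval1, Finset.card_range] at this
  have hM0 : (0 : ℝ) < M := by positivity
  have hN0 : 0 < N := by
    have : 0 < ((m : ℝ) ^ L) ^ 2 := by positivity
    exact pos_of_mul_pos_right (this.trans_le hCS) hM0.le
  refine ⟨fun k => P.coeff k / √N, fun k hk => ?_, ?_, fun z => ?_⟩
  · change P.coeff k / √N = 0
    rw [Polynomial.coeff_eq_zero_of_natDegree_lt (hdeg.trans_le hk), zero_div]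
  · simp only [div_pow, Real.sq_sqrt hN0.le]
    rw [← Finset.sum_div, div_self hN0.ne']
  · have h1 : ∑ k ∈ Finset.range M, ((P.coeff k / √N : ℝ) : ℂ) * z ^ k =
        (∑ i ∈ Finset.range m, z ^ i) ^ L / ((√N : ℝ) : ℂ) := by
      rw [← heval, Finset.sum_div]
      refine Finset.sum_congr rfl fun k _ => ?_
      push_cast
      ring
    rw [h1, norm_div, Complex.norm_real, Real.norm_of_nonneg (Real.sqrt_nonneg _), div_pow,
      Real.sq_sqrt hN0.le, norm_pow, ← pow_mul, mul_comm L 2, div_pow, ← mul_div_assoc,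
      div_le_div_iff₀ hN0 (by positivity)]
    have h2 : (m : ℝ) ^ (2 * L) ≤ M * N := by rwa [mul_comm 2 L, pow_mul]
    calc _ ≤ ‖∑ i ∈ Finset.range m, z ^ i‖ ^ (2 * L) * (M * N) := by gcongr
      _ = _ := by ring

/-- The unnormalized probability density of the estimation error for the amplitudes `a`. -/
def errorDensity (M : ℕ) (a : ℕ → ℝ) (t : ℝ) : ℝ :=
  ‖∑ k ∈ Finset.range M, (a k : ℂ) * phase t ^ k‖ ^ 2

theorem errorDensity_nonneg (M : ℕ) (a : ℕ → ℝ) (t : ℝ) : 0 ≤ errorDensity M a t := by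
  unfold errorDensity
  positivity

/-- The amplitudes are real, so reversing `t` conjugates the sum. This evenness drives the
cancellation of the bias. -/
theorem errorDensity_neg (M : ℕ) (a : ℕ → ℝ) (t : ℝ) :
    errorDensity M a (-t) = errorDensity M a t := by
  unfold errorDensity
  rw [← Complex.norm_conj (∑ k ∈ Finset.range M, (a k : ℂ) * phase t ^ k)]
  simp [map_sum, conj_phase]

theorem sum_abs_sq_le {M : ℕ} {a : ℕ → ℝ} (ha : ∑ k ∈ Finset.range M, a k ^ 2 = 1) :
    (∑ k ∈ Finset.range M, |a k|) ^ 2 ≤ M := by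
  have := sq_sum_le_card_mul_sum_sq (s := Finset.range M) (f := fun k => |a k|)
  simpa [sq_abs, ha] using this

theorem norm_pow_sub_pow_le {z w : ℂ} (hz : ‖z‖ = 1) (hw : ‖w‖ = 1) (k : ℕ) :
    ‖z ^ k - w ^ k‖ ≤ k * ‖z - w‖ := by
  induction k with
  | zero => simp
  | succ k ih =>
    have h : z ^ (k + 1) - w ^ (k + 1) = z * (z ^ k - w ^ k) + (z - w) * w ^ k := by ring
    rw [h]
    refine (norm_add_le _ _).trans ?_
    rw [norm_mul, norm_mul, norm_pow, hz, hw, one_pow, one_mul, mul_one]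
    push_cast
    linarith

/-- With `S = ∑ |a k|`, the sum inside the norm is bounded by `S` and Lipschitz with constant
`2πMS`; its squared norm then has constant `4πMS²`, and `S² ≤ M` by Cauchy–Schwarz. -/
theorem abs_errorDensity_sub_le {M : ℕ} {a : ℕ → ℝ} (ha : ∑ k ∈ Finset.range M, a k ^ 2 = 1)
    (s t : ℝ) : |errorDensity M a s - errorDensity M a t| ≤ 4 * Real.pi * M ^ 2 * |s - t| := by
  set u := ∑ k ∈ Finset.range M, (a k : ℂ) * phase s ^ k with hu
  set v := ∑ k ∈ Finset.range M, (a k : ℂ) * phase t ^ k with hv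
  set S := ∑ k ∈ Finset.range M, |a k| with hS
  have hS0 : 0 ≤ S := Finset.sum_nonneg fun _ _ => abs_nonneg _
  have hbound : ∀ r : ℝ, ‖∑ k ∈ Finset.range M, (a k : ℂ) * phase r ^ k‖ ≤ S := by
    intro r
    refine (norm_sum_le _ _).trans (Finset.sum_le_sum fun k _ => ?_)
    rw [norm_mul, norm_pow, norm_phase, one_pow, mul_one, Complex.norm_real, Real.norm_eq_abs]
  have hdiff : ‖u - v‖ ≤ S * (M * (2 * Real.pi * |s - t|)) := by
    rw [hu, hv, ← Finset.sum_sub_distrib, hS, Finset.sum_mul]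
    refine (norm_sum_le _ _).trans (Finset.sum_le_sum fun k hk => ?_)
    rw [← mul_sub, norm_mul, Complex.norm_real, Real.norm_eq_abs]
    have hkM : (k : ℝ) ≤ M := by exact_mod_cast (Finset.mem_range.1 hk).le
    have h1 := norm_pow_sub_pow_le (norm_phase s) (norm_phase t) k
    have h2 := norm_phase_sub_phase_le s t
    gcongr
    refine h1.trans ?_
    gcongr
  have hfac : errorDensity M a s - errorDensity M a t = (‖u‖ - ‖v‖) * (‖u‖ + ‖v‖) := by
    simp only [errorDensity, ← hu, ← hv]
    ring
  rw [hfac, abs_mul, abs_of_nonneg (by positivity : 0 ≤ ‖u‖ + ‖v‖)]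
  calc |‖u‖ - ‖v‖| * (‖u‖ + ‖v‖)
      ≤ (S * (M * (2 * Real.pi * |s - t|))) * (S + S) := by
        gcongr
        · exact (abs_norm_sub_norm_le _ _).trans hdiff
        · exact hbound s
        · exact hbound t
    _ = S ^ 2 * (4 * Real.pi * M * |s - t|) := by ring
    _ ≤ M * (4 * Real.pi * M * |s - t|) := by
        gcongr
        exact sum_abs_sq_le ha
    _ = _ := by ring

/-- For `m ≥ 4` one has `3/4 ≤ 1 - 1/m`, so the geometric sum is at most `m / 2` on the whole range,
and `(1/2) ^ (2L) = 1 / 4 ^ L`. -/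
theorem errorDensity_le_of_concentrated {m L : ℕ} (hm : 4 ≤ m) {a : ℕ → ℝ}
    (ha : ∀ z : ℂ, ‖∑ k ∈ Finset.range ((m - 1) * L + 1), (a k : ℂ) * z ^ k‖ ^ 2 ≤
        (((m - 1) * L + 1 : ℕ) : ℝ) * (‖∑ i ∈ Finset.range m, z ^ i‖ / m) ^ (2 * L))
    {t : ℝ} (h1 : 1 / (m : ℝ) ≤ |t|) (h2 : |t| ≤ 3 / 4) :
    errorDensity ((m - 1) * L + 1) a t ≤ (((m - 1) * L + 1 : ℕ) : ℝ) / 4 ^ L := by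
  have hm4 : (4 : ℝ) ≤ m := by exact_mod_cast hm
  have hm0 : (0 : ℝ) < m := by linarith
  have hinv : 1 / (m : ℝ) ≤ 1 / 4 := by gcongr
  have hg := norm_geom_sum_phase_le (by omega) h1 (by linarith : |t| ≤ 1 - 1 / (m : ℝ))
  have hhalf : ‖∑ i ∈ Finset.range m, phase t ^ i‖ / m ≤ 1 / 2 := by
    rw [div_le_iff₀ hm0]
    linarith
  refine (ha (phase t)).trans ?_
  calc _ ≤ (((m - 1) * L + 1 : ℕ) : ℝ) * (1 / 2 : ℝ) ^ (2 * L) := by gcongr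
    _ = _ := by rw [pow_mul, div_eq_mul_inv _ ((4 : ℝ) ^ L), ← inv_pow]; norm_num

/-! ### The Fourier transform on the grid -/

/-- The grid of `4R` equidistant estimates in `[-1/4, 3/4)`. -/
def gridPoint (R : ℕ) (x : ℕ) : ℝ := ((x : ℝ) - R) / (4 * R)

/-- The Fourier matrix with frequencies `0, …, 4R - 1` on the grid `gridPoint R`. -/
def gridFourier (R : ℕ) : Matrix (Fin (4 * R)) (Fin (4 * R)) ℂ :=
  Matrix.of fun x k => phase (k.val * -gridPoint R x) / (√(4 * R : ℝ) : ℂ)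

/-- A geometric sum whose ratio is a `4R`-th root of unity other than 1. -/
theorem sum_phase_mul_gridPoint {R : ℕ} (hR : 0 < R) {d : ℤ} (hd : d ≠ 0) (hd1 : |d| < 4 * R) :
    ∑ x : Fin (4 * R), phase (d * gridPoint R x) = 0 := by
  have hR' : (0 : ℝ) < R := by exact_mod_cast hR
  set r := phase (d / (4 * R)) with hr
  have hterm : ∀ x : ℕ, phase (d * gridPoint R x) = phase (-(d / 4)) * r ^ x := by
    intro x
    rw [hr, ← phase_nat_mul, ← phase_add, gridPoint]
    congr 1
    field_simp
    ring
  have hpow : r ^ (4 * R) = 1 := by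
    rw [hr, ← phase_nat_mul]
    have : ((4 * R : ℕ) : ℝ) * (d / (4 * R)) = d := by
      push_cast
      field_simp
    rw [this, phase_int]
  have hne : 1 - r ≠ 0 := by
    intro h
    have h0 : ‖r - 1‖ = 0 := by rw [← norm_neg, neg_sub, h, norm_zero]
    rw [hr, norm_phase_sub_one] at h0
    have hd' : (1 : ℝ) ≤ |(d : ℝ)| := by exact_mod_cast Int.one_le_abs hd
    have hd'' : |(d : ℝ)| + 1 ≤ 4 * R := by exact_mod_cast hd1
    have habs : |(d : ℝ) / (4 * R)| = |(d : ℝ)| / (4 * R) := by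
      rw [abs_div, abs_of_pos (by positivity : (0 : ℝ) < 4 * R)]
    have := two_mul_le_sin_pi_mul (δ := 1 / (4 * R : ℝ)) (t := d / (4 * R)) (by positivity)
      (by rw [habs]; gcongr)
      (by rw [habs, le_sub_iff_add_le, ← add_div, div_le_one (by positivity)]; exact hd'')
    have hpos : 0 < 2 * (1 / (4 * R : ℝ)) := by positivity
    linarith
  rw [Finset.sum_congr rfl fun x _ => hterm x.val, ← Finset.mul_sum,
    Fin.sum_univ_eq_sum_range fun x => r ^ x]
  have := mul_neg_geom_sum r (4 * R)
  rw [hpow, sub_self] at this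
  rw [(mul_eq_zero.1 this).resolve_left hne, mul_zero]

theorem gridFourier_mem_unitaryGroup {R : ℕ} (hR : 0 < R) :
    gridFourier R ∈ Matrix.unitaryGroup (Fin (4 * R)) ℂ := by
  have hR' : (0 : ℝ) < R := by exact_mod_cast hR
  rw [Matrix.mem_unitaryGroup_iff']
  ext k l
  have hsq : ((√(4 * R : ℝ) : ℝ) : ℂ) * ((√(4 * R : ℝ) : ℝ) : ℂ) = ((4 * R : ℝ) : ℂ) := by
    rw [← Complex.ofReal_mul, Real.mul_self_sqrt (by positivity)]
  have hterm : ∀ x : Fin (4 * R), star (gridFourier R x k) * gridFourier R x l =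
      phase (((k.val : ℤ) - (l.val : ℤ) : ℤ) * gridPoint R x) / ((4 * R : ℝ) : ℂ) := by
    intro x
    rw [gridFourier, Matrix.of_apply, Matrix.of_apply, RCLike.star_def, map_div₀, conj_phase,
      Complex.conj_ofReal, div_mul_div_comm, ← phase_add, hsq]
    congr 2
    push_cast
    ring
  rw [Matrix.mul_apply]
  simp only [Matrix.star_apply, hterm]
  rw [← Finset.sum_div]
  by_cases h : k = l
  · subst h
    have h1 : phase 0 = 1 := by simpa using phase_int 0
    have h2 : (R : ℂ) ≠ 0 := by exact_mod_cast hR.ne'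
    simp [h1, h2]
  · rw [Matrix.one_apply_ne h, sum_phase_mul_gridPoint hR, zero_div]
    · intro h0
      exact h (Fin.ext (by omega))
    · rw [abs_lt]
      constructor <;> omega

/-- `gridFourier` as a unitary. -/
def gridFourierUnitary {R : ℕ} (hR : 0 < R) : Matrix.unitaryGroup (Fin (4 * R)) ℂ :=
  ⟨gridFourier R, gridFourier_mem_unitaryGroup hR⟩

theorem sum_range_eq_of_support {β : Type*} [AddCommMonoid β] {M W : ℕ} (hMW : M ≤ W)
    {f : ℕ → β} (hf : ∀ k, M ≤ k → f k = 0) :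
    ∑ k : Fin W, f k = ∑ k ∈ Finset.range M, f k := by
  rw [Fin.sum_univ_eq_sum_range f W]
  refine (Finset.sum_subset (Finset.range_mono hMW) fun k _ hk => hf k ?_).symm
  simpa using hk

/-- The exponent `k + 1` instead of `k` only contributes a common factor of modulus one. -/
theorem norm_sq_gridFourier_mulVec {R M : ℕ} (hM : M ≤ 4 * R) {a : ℕ → ℝ}
    (ha : ∀ k, M ≤ k → a k = 0) (θ : ℝ) (x : Fin (4 * R)) :
    ‖(gridFourier R).mulVec (fun k => (a k : ℂ) * phase θ ^ (k.val + 1)) x‖ ^ 2 =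
      errorDensity M a (θ - gridPoint R x) / (4 * R) := by
  have h : (gridFourier R).mulVec (fun k => (a k : ℂ) * phase θ ^ (k.val + 1)) x =
      phase θ * (∑ k ∈ Finset.range M, (a k : ℂ) * phase (θ - gridPoint R x) ^ k) /
        (√(4 * R : ℝ) : ℂ) := by
    rw [← sum_range_eq_of_support hM (f := fun k : ℕ =>
      (a k : ℂ) * phase (θ - gridPoint R x) ^ k) fun k hk => by simp [ha k hk],
      Finset.mul_sum, Finset.sum_div, Matrix.mulVec, dotProduct]
    refine Finset.sum_congr rfl fun k _ => ?_
    rw [gridFourier, Matrix.of_apply, phase_nat_mul, sub_eq_add_neg θ, phase_add, mul_pow]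
    ring
  rw [h, norm_div, norm_mul, norm_phase, one_mul, div_pow, Complex.norm_real,
    Real.norm_of_nonneg (Real.sqrt_nonneg _), Real.sq_sqrt (by positivity), errorDensity]

/-- Parseval for the unitary Fourier matrix. It holds for every real `θ`, so it may be used at a
rounded phase too. -/
theorem sum_errorDensity {R M : ℕ} (hR : 0 < R) (hM : M ≤ 4 * R) {a : ℕ → ℝ}
    (ha : ∀ k, M ≤ k → a k = 0) (ha1 : ∑ k ∈ Finset.range M, a k ^ 2 = 1) (θ : ℝ) :
    ∑ x : Fin (4 * R), errorDensity M a (θ - gridPoint R x) / (4 * R) = 1 := by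
  simp only [← norm_sq_gridFourier_mulVec hM ha]
  have := sum_norm_sq_mulVec (gridFourierUnitary hR)
    (fun k => (a k : ℂ) * phase θ ^ (k.val + 1))
  refine this.trans ?_
  simp only [norm_mul, norm_pow, norm_phase, one_pow, mul_one, Complex.norm_real,
    Real.norm_eq_abs, sq_abs]
  rw [sum_range_eq_of_support hM (f := fun k => a k ^ 2) fun k hk => by simp [ha k hk], ha1]

theorem abs_sub_gridPoint_le {R : ℕ} (hR : 0 < R) {θ : ℝ} (hθ : θ ∈ Set.Icc (0 : ℝ) (1 / 2))
    (x : Fin (4 * R)) : |θ - gridPoint R x| ≤ 3 / 4 := by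
  have hR' : (0 : ℝ) < R := by exact_mod_cast hR
  have hx0 : (0 : ℝ) ≤ x.val := by positivity
  have hx : (x.val : ℝ) ≤ 4 * R := by exact_mod_cast x.2.le
  have h1 : -(1 / 4) ≤ gridPoint R x := by
    rw [gridPoint, le_div_iff₀ (by positivity)]
    linarith
  have h2 : gridPoint R x ≤ 3 / 4 := by
    rw [gridPoint, div_le_iff₀ (by positivity)]
    linarith
  rw [abs_le]
  constructor <;> linarith [hθ.1, hθ.2]

theorem gridPoint_mem_Icc {R : ℕ} (hR : 0 < R) (x : Fin (4 * R)) :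
    gridPoint R x ∈ Set.Icc (-1 : ℝ) 1 := by
  have := abs_sub_gridPoint_le hR (θ := 0) ⟨le_rfl, by norm_num⟩ x
  rw [zero_sub, abs_neg, abs_le] at this
  constructor <;> linarith [this.1, this.2]

/-! ### Second moment and bias -/

/-- Errors below `δ` contribute at most `δ²` times the total mass 1. Each of the `4R` points with a
larger error contributes at most `τ / (4R)`, since errors never exceed 1. -/
theorem sum_sq_error_le {R M : ℕ} (hR : 0 < R) (hM : M ≤ 4 * R) {a : ℕ → ℝ}
    (ha : ∀ k, M ≤ k → a k = 0) (ha1 : ∑ k ∈ Finset.range M, a k ^ 2 = 1) {δ τ : ℝ}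
    (hτ0 : 0 ≤ τ) (hτ : ∀ t : ℝ, δ ≤ |t| → |t| ≤ 3 / 4 → errorDensity M a t ≤ τ)
    {θ : ℝ} (hθ : θ ∈ Set.Icc (0 : ℝ) (1 / 2)) :
    ∑ x : Fin (4 * R), errorDensity M a (θ - gridPoint R x) / (4 * R) * (gridPoint R x - θ) ^ 2 ≤
      δ ^ 2 + τ := by
  have hR' : (0 : ℝ) < R := by exact_mod_cast hR
  have hbound : ∀ x : Fin (4 * R),
      errorDensity M a (θ - gridPoint R x) / (4 * R) * (gridPoint R x - θ) ^ 2 ≤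
        δ ^ 2 * (errorDensity M a (θ - gridPoint R x) / (4 * R)) + τ / (4 * R) := by
    intro x
    have h34 := abs_sub_gridPoint_le hR hθ x
    have hq := errorDensity_nonneg M a (θ - gridPoint R x)
    set t := θ - gridPoint R x with ht
    have hsq : (gridPoint R x - θ) ^ 2 = |t| ^ 2 := by rw [sq_abs, ht]; ring
    rw [hsq]
    by_cases h : δ ≤ |t|
    · have h1 : errorDensity M a t / (4 * R) * |t| ^ 2 ≤ τ / (4 * R) * 1 := by
        gcongr
        · exact hτ t h h34
        · exact pow_le_one₀ (abs_nonneg _) (by linarith)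
      have h2 : 0 ≤ δ ^ 2 * (errorDensity M a t / (4 * R)) := by positivity
      linarith
    · push Not at h
      have h1 : errorDensity M a t / (4 * R) * |t| ^ 2 ≤
          errorDensity M a t / (4 * R) * δ ^ 2 := by gcongr
      have h2 : 0 ≤ τ / (4 * R) := by positivity
      linarith
  refine (Finset.sum_le_sum fun x _ => hbound x).trans (le_of_eq ?_)
  rw [Finset.sum_add_distrib, ← Finset.mul_sum, sum_errorDensity hR hM ha ha1, mul_one]
  simp
  field_simp

/-- The phase `j / (4R)` is the grid point of index `R + j`. Reflecting indices about it negates the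
summands, so the window of errors below `δ` sums to zero and only the tail remains. -/
theorem sum_error_grid_le {R : ℕ} (hR : 0 < R) {q : ℝ → ℝ} (hq0 : ∀ t, 0 ≤ q t)
    (hq : ∀ t, q (-t) = q t) {δ τ : ℝ} (hτ0 : 0 ≤ τ) (hδ : δ ≤ 1 / 4)
    (hτ : ∀ t : ℝ, δ ≤ |t| → |t| ≤ 3 / 4 → q t ≤ τ) {j : ℕ} (hj : j ≤ 2 * R) :
    |∑ x : Fin (4 * R), q (j / (4 * R) - gridPoint R x) * (gridPoint R x - j / (4 * R))| ≤
      4 * R * τ := by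
  have hR' : (0 : ℝ) < R := by exact_mod_cast hR
  set g : ℕ → ℝ := fun x => q (j / (4 * R) - gridPoint R x) * (gridPoint R x - j / (4 * R))
    with hg
  have hdiff : ∀ x : ℕ, (j : ℝ) / (4 * R) - gridPoint R x = ((R + j : ℝ) - x) / (4 * R) := by
    intro x
    rw [gridPoint, ← sub_div]
    ring
  change |∑ x : Fin (4 * R), g x| ≤ _
  rw [Fin.sum_univ_eq_sum_range g (4 * R),
    ← Finset.sum_filter_add_sum_filter_not _ fun x : ℕ => |(j : ℝ) / (4 * R) - gridPoint R x| < δ]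
  have hzero : ∑ x ∈ Finset.range (4 * R) with |(j : ℝ) / (4 * R) - gridPoint R x| < δ, g x = 0 := by
    -- As `δ ≤ 1/4`, the window stays within `R` indices of its centre; with `j ≤ 2R` it does not
    -- meet the ends of the grid, so the reflection maps it to itself.
    have hwin : ∀ x : ℕ, |(j : ℝ) / (4 * R) - gridPoint R x| < δ → x < 2 * R + j ∧ j < x := by
      intro x hx
      rw [hdiff, abs_div, abs_of_pos (by positivity : (0 : ℝ) < 4 * R),
        div_lt_iff₀ (by positivity)] at hx
      have h2 : |(R + j : ℝ) - x| < R := by nlinarith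
      rw [abs_lt] at h2
      constructor
      · have : (x : ℝ) < ((2 * R + j : ℕ) : ℝ) := by push_cast; linarith [h2.1]
        exact_mod_cast this
      · have : (j : ℝ) < x := by linarith [h2.2]
        exact_mod_cast this
    have hrefl : ∀ x : ℕ, x < 2 * R + j → (j : ℝ) / (4 * R) - gridPoint R (2 * (R + j) - x) =
        -((j : ℝ) / (4 * R) - gridPoint R x) := by
      intro x hx
      rw [hdiff, hdiff, ← neg_div, Nat.cast_sub (by omega)]
      push_cast
      ring
    have hneg : ∑ x ∈ Finset.range (4 * R) with |(j : ℝ) / (4 * R) - gridPoint R x| < δ, g x =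
        ∑ x ∈ Finset.range (4 * R) with |(j : ℝ) / (4 * R) - gridPoint R x| < δ, -g x := by
      have hmem : ∀ x ∈ (Finset.range (4 * R)).filter
          (fun x : ℕ => |(j : ℝ) / (4 * R) - gridPoint R x| < δ), 2 * (R + j) - x ∈
            (Finset.range (4 * R)).filter
              (fun x : ℕ => |(j : ℝ) / (4 * R) - gridPoint R x| < δ) := by
        intro x hx
        rw [Finset.mem_filter] at hx ⊢
        have h := hwin x hx.2
        refine ⟨Finset.mem_range.2 (by omega), ?_⟩
        rw [hrefl x h.1, abs_neg]
        exact hx.2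
      refine Finset.sum_nbij' (fun x => 2 * (R + j) - x) (fun x => 2 * (R + j) - x)
        hmem hmem ?_ ?_ ?_
      · intro x hx
        have h := hwin x (Finset.mem_filter.1 hx).2
        change 2 * (R + j) - (2 * (R + j) - x) = x
        omega
      · intro x hx
        have h := hwin x (Finset.mem_filter.1 hx).2
        change 2 * (R + j) - (2 * (R + j) - x) = x
        omega
      · intro x hx
        have h := hwin x (Finset.mem_filter.1 hx).2
        have hr := hrefl x h.1
        have hr' : gridPoint R (2 * (R + j) - x) - (j : ℝ) / (4 * R) =
            -(gridPoint R x - (j : ℝ) / (4 * R)) := by linarith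
        simp only [hg]
        rw [hr, hr', hq]
        ring
    rw [Finset.sum_neg_distrib] at hneg
    linarith
  rw [hzero, zero_add]
  calc _ ≤ ∑ x ∈ Finset.range (4 * R) with ¬ |(j : ℝ) / (4 * R) - gridPoint R x| < δ, |g x| :=
        Finset.abs_sum_le_sum_abs _ _
    _ ≤ ∑ x ∈ Finset.range (4 * R) with ¬ |(j : ℝ) / (4 * R) - gridPoint R x| < δ, τ := by
        refine Finset.sum_le_sum fun x hx => ?_
        rw [Finset.mem_filter, Finset.mem_range, not_lt] at hx
        have h34 := abs_sub_gridPoint_le hR (θ := (j : ℝ) / (4 * R))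
          ⟨by positivity, by
            rw [div_le_iff₀ (by positivity)]
            have : (j : ℝ) ≤ 2 * R := by exact_mod_cast hj
            linarith⟩ ⟨x, hx.1⟩
        simp only at h34
        simp only [hg]
        rw [abs_mul, abs_of_nonneg (hq0 _), abs_sub_comm (gridPoint R x)]
        calc _ ≤ τ * 1 := by
              gcongr
              · exact hτ _ hx.2 h34
              · linarith
          _ = τ := mul_one τ
    _ ≤ ∑ x ∈ Finset.range (4 * R), τ :=
        Finset.sum_le_sum_of_subset_of_nonneg (Finset.filter_subset _ _) fun _ _ _ => hτ0
    _ = _ := by simp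

theorem abs_sum_error_le {R M : ℕ} (hR : 0 < R) (hM0 : 0 < M) (hM : M ≤ 4 * R) {a : ℕ → ℝ}
    (ha : ∀ k, M ≤ k → a k = 0) (ha1 : ∑ k ∈ Finset.range M, a k ^ 2 = 1) {δ τ : ℝ}
    (hτ0 : 0 ≤ τ) (hδ : δ ≤ 1 / 4)
    (hτ : ∀ t : ℝ, δ ≤ |t| → |t| ≤ 3 / 4 → errorDensity M a t ≤ τ)
    {θ : ℝ} (hθ : θ ∈ Set.Icc (0 : ℝ) (1 / 2)) :
    |(∑ x : Fin (4 * R), errorDensity M a (θ - gridPoint R x) / (4 * R) * gridPoint R x) - θ| ≤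
      τ + 4 * M ^ 2 / R := by
  have hR' : (0 : ℝ) < R := by exact_mod_cast hR
  set W : ℝ := 4 * R with hW
  have hW0 : 0 < W := by positivity
  set j := ⌊θ * W⌋₊ with hj
  have hθW : 0 ≤ θ * W := mul_nonneg hθ.1 hW0.le
  have hj1 : (j : ℝ) ≤ θ * W := Nat.floor_le hθW
  have hj2 : θ * W < j + 1 := Nat.lt_floor_add_one _
  have hjR : j ≤ 2 * R := by
    have : (j : ℝ) ≤ ((2 * R : ℕ) : ℝ) := by
      push_cast
      nlinarith [hθ.2]
    exact_mod_cast this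
  set η : ℝ := j / W with hη
  have hdist : |θ - η| ≤ 1 / W := by
    have h1 : η ≤ θ := by rw [hη, div_le_iff₀ hW0]; exact hj1
    have h2 : θ - η ≤ 1 / W := by
      rw [hη, le_div_iff₀ hW0, sub_mul, div_mul_cancel₀ _ hW0.ne']
      linarith
    rwa [abs_of_nonneg (by linarith)]
  set q := errorDensity M a with hq
  -- The three terms are the change of the law when `θ` is rounded down to the grid point `η`, the
  -- bias at `η`, and the rounding error itself.
  have hsplit : (∑ x : Fin (4 * R), q (θ - gridPoint R x) / W * gridPoint R x) - θ =
      (∑ x : Fin (4 * R), (q (θ - gridPoint R x) - q (η - gridPoint R x)) / W * gridPoint R x) +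
      (∑ x : Fin (4 * R), q (η - gridPoint R x) * (gridPoint R x - η)) / W + (η - θ) := by
    have h1 := sum_errorDensity hR hM ha ha1 η
    have h2 : (∑ x : Fin (4 * R), q (η - gridPoint R x) * (gridPoint R x - η)) / W =
        (∑ x : Fin (4 * R), q (η - gridPoint R x) / W * gridPoint R x) -
          η * ∑ x : Fin (4 * R), q (η - gridPoint R x) / W := by
      rw [Finset.sum_div, Finset.mul_sum, ← Finset.sum_sub_distrib]
      exact Finset.sum_congr rfl fun x _ => by ring
    rw [h1] at h2
    rw [h2, ← sub_eq_zero]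
    simp only [sub_div, sub_mul, Finset.sum_sub_distrib]
    ring
  have hfirst : |∑ x : Fin (4 * R),
      (q (θ - gridPoint R x) - q (η - gridPoint R x)) / W * gridPoint R x| ≤
        4 * Real.pi * M ^ 2 * (1 / W) := by
    refine (Finset.abs_sum_le_sum_abs _ _).trans ?_
    have hx : ∀ x : Fin (4 * R),
        |(q (θ - gridPoint R x) - q (η - gridPoint R x)) / W * gridPoint R x| ≤
          4 * Real.pi * M ^ 2 * (1 / W) / W * 1 := by
      intro x
      rw [abs_mul, abs_div, abs_of_pos hW0]
      have hl := abs_errorDensity_sub_le ha1 (θ - gridPoint R x) (η - gridPoint R x)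
      rw [sub_sub_sub_cancel_right] at hl
      gcongr
      · exact hl.trans (by gcongr)
      · exact abs_le.2 (gridPoint_mem_Icc hR x)
    refine (Finset.sum_le_sum fun x _ => hx x).trans (le_of_eq ?_)
    rw [Finset.sum_const, Finset.card_univ, Fintype.card_fin, nsmul_eq_mul, mul_one]
    push_cast
    rw [← hW]
    field_simp
  have hsecond : |(∑ x : Fin (4 * R), q (η - gridPoint R x) * (gridPoint R x - η)) / W| ≤ τ := by
    rw [abs_div, abs_of_pos hW0, div_le_iff₀ hW0, mul_comm τ]
    exact sum_error_grid_le hR (errorDensity_nonneg M a) (errorDensity_neg M a) hτ0 hδ hτ hjR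
  rw [hsplit]
  refine (abs_add_three _ _ _).trans ?_
  rw [abs_sub_comm η]
  have hM1 : (1 : ℝ) ≤ M := by exact_mod_cast hM0
  have hfinal : 4 * Real.pi * M ^ 2 * (1 / W) + 1 / W ≤ 4 * M ^ 2 / R := by
    rw [hW]
    have h1 : 4 * Real.pi * M ^ 2 * (1 / (4 * R : ℝ)) + 1 / (4 * R : ℝ) =
        (4 * Real.pi * M ^ 2 + 1) / 4 / R := by
      field_simp
    rw [h1]
    gcongr
    nlinarith [Real.pi_lt_d2]
  linarith

/-! ### Existence of an unbiased phase estimator -/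

/-- Phase estimation with `(m - 1) L + 2` queries and estimates on a grid of `4 R` points. -/
theorem exists_phase_estimation_algorithm (n : ℕ) {m L R : ℕ} (hm : 4 ≤ m)
    (hR : (m - 1) * L + 1 ≤ R) :
    ∃ A : QueryAlgorithm n, A.queries = (m - 1) * L + 2 ∧
      (∀ x, A.output x ∈ Set.Icc (-1 : ℝ) 1) ∧
      ∀ (U : Matrix.unitaryGroup (Fin n) ℂ) (ψ : EuclideanSpace ℂ (Fin n)) (θ : ℝ),
        IsPhaseInstance U ψ θ →
          |(∫ y, y ∂(A.outputLaw U ψ)) - θ| ≤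
            (((m - 1) * L + 1 : ℕ) : ℝ) / 4 ^ L + 4 * (((m - 1) * L + 1 : ℕ) : ℝ) ^ 2 / R ∧
          ProbabilityTheory.variance id (A.outputLaw U ψ) ≤
            (1 / (m : ℝ)) ^ 2 + (((m - 1) * L + 1 : ℕ) : ℝ) / 4 ^ L := by
  obtain ⟨a, ha, ha1, haz⟩ := exists_concentrated_amplitudes (by omega : 0 < m) L
  have hτ : ∀ t : ℝ, 1 / (m : ℝ) ≤ |t| → |t| ≤ 3 / 4 → _ := fun t h1 h2 =>
    errorDensity_le_of_concentrated hm haz h1 h2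
  set M := (m - 1) * L + 1 with hM
  have hR0 : 0 < R := by omega
  have hM4 : M ≤ 4 * R := by omega
  have hm4 : (4 : ℝ) ≤ m := by exact_mod_cast hm
  obtain ⟨V, hV⟩ := exists_unitary_col (⟨0, by omega⟩ : Fin (4 * R)) (fun k => (a k : ℂ)) (by
    simp only [Complex.norm_real, Real.norm_eq_abs, sq_abs]
    rw [sum_range_eq_of_support hM4 (f := fun k => a k ^ 2) fun k hk => by simp [ha k hk], ha1])
  have hV0 : ∀ k : Fin (4 * R), M ≤ k.val → V.val k ⟨0, by omega⟩ = 0 := fun k hk => by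
    rw [hV, ha k hk, Complex.ofReal_zero]
  refine ⟨phaseAlgorithm n M ⟨0, by omega⟩ V (gridFourierUnitary hR0) fun x => gridPoint R x,
    ?_, fun x => gridPoint_mem_Icc hR0 x.1, fun U ψ θ h => ?_⟩
  · exact queries_phaseAlgorithm _ _ _ _
  obtain ⟨hψ, hθ, hU⟩ := h
  have hint : ∀ f : ℝ → ℝ, ∫ t, f t ∂((phaseAlgorithm n M ⟨0, by omega⟩ V
      (gridFourierUnitary hR0) fun x => gridPoint R x).outputLaw U ψ) =
      ∑ x : Fin (4 * R), errorDensity M a (θ - gridPoint R x) / (4 * R) * f (gridPoint R x) := by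
    intro f
    rw [integral_outputLaw_phaseAlgorithm _ _ _ _ hV0 hψ hU]
    refine Finset.sum_congr rfl fun x _ => ?_
    rw [← norm_sq_gridFourier_mulVec hM4 ha]
    simp only [hV]
    rfl
  constructor
  · rw [hint fun y => y]
    exact abs_sum_error_le hR0 (by omega) hM4 ha ha1 (by positivity)
      (by gcongr) hτ hθ
  · have := (phaseAlgorithm n M ⟨0, by omega⟩ V (gridFourierUnitary hR0)
      fun x => gridPoint R x).isProbabilityMeasure_outputLaw U hψ
    -- The variance is at most the second moment about any point, here about `θ`.
    rw [← ProbabilityTheory.variance_sub_const aestronglyMeasurable_id θ]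
    refine (ProbabilityTheory.variance_le_expectation_sq (by fun_prop)).trans ?_
    have h2 := hint fun y => (y - θ) ^ 2
    refine (le_of_eq h2).trans ?_
    exact sum_sq_error_le hR0 hM4 ha ha1 (by positivity) hτ hθ

theorem exists_phase_estimation_of_parameters (n : ℕ) {K B : ℝ} (hK : 1 ≤ K) (hB : 0 < B)
    (hB1 : B < 1) :
    ∃ A : QueryAlgorithm n, (A.queries : ℝ) ≤ 16 * K * (Real.log (K / B) + 5) ∧
      (∀ x, A.output x ∈ Set.Icc (-1 : ℝ) 1) ∧
      ∀ (U : Matrix.unitaryGroup (Fin n) ℂ) (ψ : EuclideanSpace ℂ (Fin n)) (θ : ℝ),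
        IsPhaseInstance U ψ θ →
          |(∫ y, y ∂(A.outputLaw U ψ)) - θ| ≤ B ∧
          ProbabilityTheory.variance id (A.outputLaw U ψ) ≤ 1 / K ^ 2 + B := by
  -- The factor 4 ensures `m ≥ 4`, while `K ≤ m ≤ 8K`.
  set m := 4 * ⌈K⌉₊ with hm
  set l := ⌈Real.log (2 * m / B)⌉₊ with hl
  have hceil : 1 ≤ ⌈K⌉₊ := Nat.one_le_ceil_iff.2 (by linarith)
  have hm4 : 4 ≤ m := by omega
  have hmK : K ≤ m := by
    have := Nat.le_ceil K
    rw [hm]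
    push_cast
    linarith
  have hmK8 : (m : ℝ) ≤ 8 * K := by
    have := Nat.ceil_lt_add_one (show 0 ≤ K by linarith)
    rw [hm]
    push_cast
    linarith
  have hm0 : (4 : ℝ) ≤ m := by exact_mod_cast hm4
  have hlog0 : 0 < Real.log (2 * m / B) :=
    Real.log_pos (by rw [lt_div_iff₀ hB]; linarith)
  have hl1 : 1 ≤ l := Nat.ceil_pos.2 hlog0
  set M := (m - 1) * (2 * l) + 1 with hM
  have hMm : M ≤ m * (2 * l) := by
    obtain ⟨m', hm'⟩ : ∃ m', m = m' + 1 := ⟨m - 1, by omega⟩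
    rw [hM, hm', Nat.add_sub_cancel, add_mul]
    omega
  have hMm' : (M : ℝ) ≤ m * (2 * l) := by exact_mod_cast hMm
  have hexp : 2 * m / B ≤ 4 ^ l := by
    calc 2 * m / B = Real.exp (Real.log (2 * m / B)) := (Real.exp_log (by positivity)).symm
      _ ≤ Real.exp l := Real.exp_le_exp.2 (Nat.le_ceil _)
      _ = Real.exp 1 ^ l := by rw [← Real.exp_nat_mul, mul_one]
      _ ≤ 4 ^ l := by
          gcongr
          linarith [Real.exp_one_lt_d9]
  -- With `L = 2l`, one factor `4 ^ l` beats `2m / B` and the other absorbs the factor `2l` in `M ≤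
  -- 2ml`.
  have htail : (M : ℝ) / 4 ^ (2 * l) ≤ B / 2 := by
    have h1 : (2 * l : ℝ) ≤ 4 ^ l := by
      have : 2 * l < 2 ^ (2 * l) := Nat.lt_two_pow_self
      have h2 : (2 * l : ℝ) ≤ 2 ^ (2 * l) := by exact_mod_cast this.le
      rw [pow_mul] at h2
      norm_num at h2
      exact h2
    rw [div_le_iff₀ (by positivity)] at hexp
    rw [div_le_iff₀ (by positivity), two_mul l, pow_add]
    have h3 : (0 : ℝ) < 4 ^ l := by positivity
    calc (M : ℝ) ≤ m * (2 * l) := hMm'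
      _ ≤ m * 4 ^ l := by gcongr
      _ ≤ (4 ^ l * B / 2) * 4 ^ l := by gcongr; linarith
      _ = _ := by ring
  -- Large enough that the rounding bias `4M² / R` takes only the other half of `B`.
  set R := M + ⌈8 * (M : ℝ) ^ 2 / B⌉₊ with hR
  have hRM : 4 * (M : ℝ) ^ 2 / R ≤ B / 2 := by
    have h1 := Nat.le_ceil (8 * (M : ℝ) ^ 2 / B)
    have hM0 : (0 : ℝ) < M := by positivity
    have h2 : 8 * (M : ℝ) ^ 2 / B ≤ R := by
      rw [hR]
      push_cast
      linarith
    have hR0 : (0 : ℝ) < R := lt_of_lt_of_le (by positivity) h2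
    rw [div_le_iff₀ hB] at h2
    rw [div_le_iff₀ hR0]
    linarith
  obtain ⟨A, hA1, hA2, hA3⟩ := exists_phase_estimation_algorithm n (L := 2 * l) (R := R) hm4
    (by omega)
  refine ⟨A, ?_, hA2, fun U ψ θ h => ⟨?_, ?_⟩⟩
  · have hq : (A.queries : ℝ) = M + 1 := by
      rw [hA1, hM]
      push_cast
      ring
    have hlle : (l : ℝ) ≤ Real.log (K / B) + 4 := by
      have h1 := Nat.ceil_lt_add_one hlog0.le
      have h2 : Real.log (2 * m / B) ≤ Real.log (16 * (K / B)) := by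
        refine Real.log_le_log (by positivity) ?_
        rw [← mul_div_assoc]
        exact div_le_div_of_nonneg_right (by linarith) hB.le
      have h3 : Real.log (16 * (K / B)) = 4 * Real.log 2 + Real.log (K / B) := by
        rw [Real.log_mul (by norm_num) (by positivity), show (16 : ℝ) = 2 ^ 4 by norm_num,
          Real.log_pow]
        norm_num
      have h4 := Real.log_two_lt_d9
      linarith
    rw [hq]
    have : (m : ℝ) * (2 * l) ≤ 8 * K * (2 * (Real.log (K / B) + 4)) := by gcongr
    linarith
  · have := (hA3 U ψ θ h).1
    linarith
  · have h2 := (hA3 U ψ θ h).2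
    have h3 : (1 / (m : ℝ)) ^ 2 ≤ 1 / K ^ 2 := by
      rw [div_pow, one_pow]
      gcongr
    linarith

theorem exists_isUnbiasedPhaseEstimation :
    ∃ A : (n : ℕ) → ℝ → ℝ → QueryAlgorithm n, IsUnbiasedPhaseEstimation A := by
  have hex : ∀ (n : ℕ) (K B : ℝ), ∃ A : QueryAlgorithm n, 1 ≤ K → 0 < B → B < 1 →
      (A.queries : ℝ) ≤ 16 * K * (Real.log (K / B) + 5) ∧
      (∀ x, A.output x ∈ Set.Icc (-1 : ℝ) 1) ∧
      ∀ (U : Matrix.unitaryGroup (Fin n) ℂ) (ψ : EuclideanSpace ℂ (Fin n)) (θ : ℝ),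
        IsPhaseInstance U ψ θ →
          |(∫ y, y ∂(A.outputLaw U ψ)) - θ| ≤ B ∧
          ProbabilityTheory.variance id (A.outputLaw U ψ) ≤ 1 / K ^ 2 + B := by
    intro n K B
    by_cases h : 1 ≤ K ∧ 0 < B ∧ B < 1
    · obtain ⟨A, hA⟩ := exists_phase_estimation_of_parameters n h.1 h.2.1 h.2.2
      exact ⟨A, fun _ _ _ => hA⟩
    · exact ⟨⟨1, 0, 1, [], fun _ => 0⟩, fun h1 h2 h3 => absurd ⟨h1, h2, h3⟩ h⟩
  choose A hA using hex
  refine ⟨A, fun n K B h1 h2 h3 => (hA n K B h1 h2 h3).2.1,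
    fun n K B h1 h2 h3 U ψ θ h => ((hA n K B h1 h2 h3).2.2 U ψ θ h).1,
    fun n K B h1 h2 h3 U ψ θ h => ((hA n K B h1 h2 h3).2.2 U ψ θ h).2, fun B₁ hB₁ => ?_⟩
  -- Since `log (K / B) ≥ log (1 / B₁) > 0`, the additive 5 is absorbed; this is where `B` must stay
  -- away from 1.
  refine ⟨16 * (1 + 5 / Real.log (1 / B₁)), fun n K B hK hB hBB => ?_⟩
  have hB₁0 : 0 < B₁ := hB.trans_le hBB
  have hlog : 0 < Real.log (1 / B₁) := Real.log_pos (by rw [lt_div_iff₀ hB₁0]; linarith)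
  have hle : Real.log (1 / B₁) ≤ Real.log (K / B) :=
    Real.log_le_log (by positivity) (by gcongr)
  refine (hA n K B hK hB (hBB.trans_lt hB₁)).1.trans ?_
  have h5 : 5 ≤ 5 / Real.log (1 / B₁) * Real.log (K / B) := by
    rw [div_mul_eq_mul_div, le_div_iff₀ hlog]
    gcongr
  calc 16 * K * (Real.log (K / B) + 5)
      ≤ 16 * K * (Real.log (K / B) + 5 / Real.log (1 / B₁) * Real.log (K / B)) := by gcongr
    _ = _ := by ring

end

theorem mainTheorem5 :
    (∃ A : (n : ℕ) → ℝ → ℝ → QueryAlgorithm n, IsUnbiasedPhaseEstimation A) ∧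
    ∀ A : (n : ℕ) → ℝ → ℝ → QueryAlgorithm n, IsUnbiasedPhaseEstimation A →
      (∀ β ε : ℝ, 0 ≤ β → β ≤ 1 → 0 < ε → ε < 1 →
        ∀ (n : ℕ) (U : Matrix.unitaryGroup (Fin n) ℂ) (ψ : EuclideanSpace ℂ (Fin n)) (θ : ℝ),
          IsPhaseInstance U ψ θ →
            1 / 2 < sampleMeanLaw (lowDepthRuns A n β ε) U ψ {a | |a - θ| ≤ ε}) ∧
      (∀ ε₁ : ℝ, ε₁ < 1 → ∃ C : ℝ, ∀ β ε : ℝ, 0 ≤ β → β ≤ 1 → 0 < ε → ε ≤ ε₁ → ∀ n : ℕ,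
        (parallelDepth (lowDepthRuns A n β ε) : ℝ) ≤ C * (ε ^ (-1 + β) * Real.log (1 / ε)) ∧
        (totalQueries (lowDepthRuns A n β ε) : ℝ) ≤
          C * (ε ^ (-1 - β) * Real.log (1 / ε))) :=
  ⟨exists_isUnbiasedPhaseEstimation, fun _ hA =>
    ⟨fun _ _ _ hβ1 hε hε1 _ U _ _ h => lowDepthRuns_accurate hA hβ1 hε hε1 U h,
      fun _ hε₁ => lowDepthRuns_resources hA hε₁⟩⟩
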